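/- Let $\nu$ be a Lévy measure on $\mathbb{R}$ (that is, $\nu(\{0\})=0$ and $\int\min(1,z^2)\,\nu(dz)<\infty$) such that $\nu(dz)=s(z)\,dz$ with $s\ge 0$, $s\in C^\infty(\mathbb{R}\setminus\{0\})$ and $\sup_{|z|>\delta}|s^{(k)}(z)|<\infty$ for all $k\ge 0$, $\delta>0$, and such that $\int_{|z|>1}e^{c|z|}\,\nu(dz)<\infty$ for some $c>2$. Let $b,\sigma\in\mathbb{R}$ and let $Z=(Z_t)_{t\ge 0}$ be a Lévy process with triplet $(b,\sigma^2,\nu)$, i.e. $$\mathbb{E}\,e^{iuZ_t}=\exp\Big(t\Big[ibu-\tfrac{\sigma^2u^2}{2}+\int_{\mathbb{R}}\big(e^{iuz}-1-iuz\mathbf{1}_{|z|\le 1}\big)\nu(dz)\Big]\Big).$$ Let $z_0<0$, $n\ge 1$ and $0<\varepsilon<\min\{-z_0/(2(n+1)),\,1\}$, and let $c_\varepsilon\in C^\infty(\mathbb{R})$ be symmetric with $\mathbf{1}_{[-\varepsilon/2,\varepsilon/2]}\le c_\varepsilon\le\mathbf{1}_{[-\varepsilon,\varepsilon]}$. Put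 $\bar c_\varepsilon=1-c_\varepsilon$, $\bar s_\varepsilon=\bar c_\varepsilon s$, $\lambda_\varepsilon=\int\bar c_\varepsilon\,d\nu$, $b_\varepsilon=b-\int_{|z|\le 1}z\,\bar c_\varepsilon(z)\,\nu(dz)$, let $\bar s_\varepsilon^{*1}=\bar s_\varepsilon$, $\bar s_\varepsilon^{*k}(x)=\int\bar s_\varepsilon^{*(k-1)}(x-u)\,\bar s_\varepsilon(u)\,du$ for $k\ge 2$, and $$L_\varepsilon g(y)=b_\varepsilon g'(y)+\tfrac{\sigma^2}{2}g''(y)+\int_{\mathbb{R}\setminus\{0\}}\big(g(y+z)-g(y)-zg'(y)\mathbf{1}_{|z|\le 1}\big)c_\varepsilon(z)\,\nu(dz).$$ For $z\in\mathbb{R}$ and $t\geq 0$, let $G_t(z)=\mathbb{E}\,(e^{z+Z_t}-1)_+$. Then $G_t(z)$ is finite for all $t\ge 0$ and $z\in\mathbb{R}$, and there are $t_0>0$ and $C<\infty$ such that for all $z<z_0$ and $0<t\le t_0$ $$\Big|G_t(z)-e^{-\lambda_\varepsilon t}\sum_{j=1}^n c_j(z)\frac{t^j}{j!}\Big|\le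 C\,t^{n+1},$$ where $$c_j(z)=\sum_{k=1}^{j}\binom{j}{k}\big(L_\varepsilon^{\,j-k}\widehat h_{k,z}\big)(0),\qquad \widehat h_{k,z}(y)=\int_{\mathbb{R}}(e^{z+y+u}-1)_+\,\bar s_\varepsilon^{*k}(u)\,du .$$ -/

import Mathlib

open MeasureTheory ProbabilityTheory Filter Topology
open scoped NNReal

noncomputable section

namespace LevyOption

/-- `ν` is a Lévy measure on `ℝ`: no mass at the origin and `∫ min(1, z²) ν(dz) < ∞`. -/
def IsLevyMeasure (ν : Measure ℝ) : Prop :=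
  ν {0} = 0 ∧ ∫⁻ z, ENNReal.ofReal (min 1 (z ^ 2)) ∂ν < ⊤

/-- The Lévy–Khintchine exponent of the triplet `(b, σ², ν)`, relative to the truncation
`z 1_{|z| ≤ 1}`. -/
def levyExponent (b σ : ℝ) (ν : Measure ℝ) (u : ℝ) : ℂ :=
  Complex.I * (b * u : ℝ) - ((σ ^ 2 * u ^ 2 / 2 : ℝ) : ℂ)
    + ∫ z, (Complex.exp (Complex.I * (u * z : ℝ)) - 1
        - Complex.I * ((u * z * Set.indicator {x : ℝ | |x| ≤ 1} 1 z : ℝ) : ℂ)) ∂ν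

/-- `Z` is a real Lévy process under `P`: it starts at `0`, has independent and stationary
increments, and almost all of its paths are right-continuous with left limits. -/
structure IsLevyProcess {Ω : Type*} [MeasurableSpace Ω] (Z : ℝ≥0 → Ω → ℝ) (P : Measure Ω) :
    Prop where
  measurable : ∀ t, Measurable (Z t)
  zero : ∀ᵐ ω ∂P, Z 0 ω = 0
  indep : HasIndepIncrements Z P
  stationary : ∀ r t : ℝ≥0, IdentDistrib (fun ω => Z (r + t) ω - Z r ω) (Z t) P P
  cadlag : ∀ᵐ ω ∂P, ∀ t : ℝ≥0,
    ContinuousWithinAt (fun r => Z r ω) (Set.Ici t) t ∧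
      ∃ l : ℝ, Tendsto (fun r => Z r ω) (𝓝[<] t) (𝓝 l)

/-- `Z` is a Lévy process with generating triplet `(b, σ², ν)`:
`E exp(i u Z_t) = exp(t ψ(u))` with `ψ` the exponent of the triplet. -/
structure IsLevyProcessWithTriplet {Ω : Type*} [MeasurableSpace Ω] (Z : ℝ≥0 → Ω → ℝ)
    (P : Measure Ω) (b σ : ℝ) (ν : Measure ℝ) : Prop extends IsLevyProcess Z P where
  levyMeasure : IsLevyMeasure ν
  charFun_eq : ∀ (t : ℝ≥0) (u : ℝ),
    charFun (P.map (Z t)) u = Complex.exp (((t : ℝ) : ℂ) * levyExponent b σ ν u)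

/-- `ν(dz) = s(z) dz` with `s ≥ 0` smooth away from the origin, and every derivative of `s`
bounded outside every neighbourhood of the origin. -/
structure HasSmoothDensity (ν : Measure ℝ) (s : ℝ → ℝ) : Prop where
  nonneg : ∀ z, z ≠ 0 → 0 ≤ s z
  eq_withDensity : ν = volume.withDensity (fun z => ENNReal.ofReal (s z))
  contDiffOn : ContDiffOn ℝ (⊤ : ℕ∞) s {0}ᶜ
  bounded : ∀ (k : ℕ) (δ : ℝ), 0 < δ → ∃ γ : ℝ, ∀ z, δ < |z| → |iteratedDeriv k s z| ≤ γ

/-- `∫_{|z|>1} e^{c|z|} ν(dz) < ∞` for some `c > 2`. -/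
def HasExpMoment (ν : Measure ℝ) : Prop :=
  ∃ c : ℝ, 2 < c ∧ ∫⁻ z in {z : ℝ | 1 < |z|}, ENNReal.ofReal (Real.exp (c * |z|)) ∂ν < ⊤

/-- A smooth symmetric truncation function with
`1_{[-ε/2, ε/2]} ≤ c ≤ 1_{[-ε, ε]}` pointwise. -/
structure IsTruncation (ε : ℝ) (c : ℝ → ℝ) : Prop where
  contDiff : ContDiff ℝ (⊤ : ℕ∞) c
  symm : ∀ z, c (-z) = c z
  lower : ∀ z, Set.indicator (Set.Icc (-(ε / 2)) (ε / 2)) 1 z ≤ c z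
  upper : ∀ z, c z ≤ Set.indicator (Set.Icc (-ε) ε) 1 z

/-- `λ_ε = ∫ (1 - c_ε(z)) ν(dz)`. -/
def jumpIntensity (ν : Measure ℝ) (c : ℝ → ℝ) : ℝ :=
  ∫ z, (1 - c z) ∂ν

/-- `b_ε = b - ∫_{|z| ≤ 1} z (1 - c_ε(z)) ν(dz)`. -/
def truncatedDrift (b : ℝ) (ν : Measure ℝ) (c : ℝ → ℝ) : ℝ :=
  b - ∫ z in {z : ℝ | |z| ≤ 1}, z * (1 - c z) ∂ν

/-- The generator `L_ε` of the small-jump part, a Lévy process with triplet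
`(b_ε, σ², c_ε(z) ν(dz))`. -/
def smallJumpGenerator (b σ : ℝ) (ν : Measure ℝ) (c : ℝ → ℝ) (g : ℝ → ℝ) (y : ℝ) : ℝ :=
  truncatedDrift b ν c * deriv g y + σ ^ 2 / 2 * iteratedDeriv 2 g y
    + ∫ z, (g (y + z) - g y - z * deriv g y * Set.indicator {x : ℝ | |x| ≤ 1} 1 z) * c z ∂ν

/-- The convolution powers `f^{*1} = f`, `f^{*k}(x) = ∫ f^{*(k-1)}(x - u) f(u) du` for `k ≥ 2`.
The value at `k = 0` is a convention that is never used. -/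
def convPow (f : ℝ → ℝ) : ℕ → ℝ → ℝ
  | 0 => fun _ => 0
  | 1 => f
  | k + 2 => fun x => ∫ u, convPow f (k + 1) (x - u) * f u

/-- `ĥ_{k,z}(y) = ∫ (e^{z+y+u} - 1)₊ s̄_ε^{*k}(u) du`, where `s̄_ε = (1 - c_ε) s`. -/
def hHat (s c : ℝ → ℝ) (k : ℕ) (z y : ℝ) : ℝ :=
  ∫ u, max (Real.exp (z + y + u) - 1) 0 * convPow (fun v => (1 - c v) * s v) k u

/-- `c_j(z) = ∑_{k=1}^j binom(j,k) (L_ε^{j-k} ĥ_{k,z})(0)`. -/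
def coeff (b σ : ℝ) (ν : Measure ℝ) (s c : ℝ → ℝ) (j : ℕ) (z : ℝ) : ℝ :=
  ∑ k ∈ Finset.Icc 1 j,
    (j.choose k : ℝ) * ((smallJumpGenerator b σ ν c)^[j - k] (hHat s c k z)) 0

/-- `G_t(z) = E (e^{z + Z_t} - 1)₊`. -/
def callPrice {Ω : Type*} [MeasurableSpace Ω] (Z : ℝ≥0 → Ω → ℝ) (P : Measure Ω)
    (t : ℝ≥0) (z : ℝ) : ℝ :=
  ∫ ω, max (Real.exp (z + Z t ω) - 1) 0 ∂P

end LevyOption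

end

/-! The jumps split as ν = cν + (1-c)ν, and the law of `Z t` is the convolution of a small-jump law
μ_t, with triplet (b_ε, σ², cν), and the compound Poisson law of the finite measure (1-c)ν.
Conditioning on the number k of big jumps writes the call price as e^{-λt} ∑ (tᵏ/k!) times the
μ_t-mean of the payoff smoothed by k big jumps.

For 1 ≤ k ≤ n the smoothed payoff `hHat` has all derivatives bounded by `weight`, uniformly in z ≤ 0
(`growthBound_call`), so its μ_t-mean has a Taylor expansion in t, through powers of the generator,
with remainder t^{n+1-k}. For k > n the factor tᵏ is already at most t^{n+1} when t ≤ 1. For k = 0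
the payoff is not smooth, but it vanishes below 2(n+1)ε and lies under a smooth φ vanishing below
(n+1)ε. A small jump has size at most ε, so n applications of the generator cannot bring the support
of φ to 0: every Taylor coefficient up to order n vanishes and the term is O(t^{n+1}). Regrouping by
total power of t gives `coeff` (`sum_coeff_eq`).

The expansion of the μ_t-means is obtained without constructing the small-jump semigroup. The
generator is approximated by that of a compound Poisson process with finite jump measure
`approxMeasure`: jumps ±h reproduce drift, diffusion and compensation, and the jumps smaller than h
are dropped. For compound Poisson laws the expansion in time is calculus on an exponential series
(`abs_integral_compoundPoisson_sub_le`). The total mass explodes as h → 0, but the mean and the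
second moment of `approxMeasure` do not, so iterated generators are bounded uniformly in h on
functions with enough derivatives. The inequality then passes to the limit h → 0: characteristic
functions converge, hence laws converge weakly, and a uniform bound on the moment of e^{2x} makes
the payoff, which grows only like eˣ, uniformly integrable. -/

noncomputable section

namespace LevyOption

open scoped ENNReal ContDiff

/-! ### Compound Poisson laws: exponential moments and characteristic functions. -/

/-- Convolution powers of a measure. -/
def convMPow (α : Measure ℝ) : ℕ → Measure ℝ
  | 0 => Measure.dirac 0
  | k + 1 => Measure.conv (convMPow α k) α

instance isFiniteMeasure_convMPow (α : Measure ℝ) [IsFiniteMeasure α] (k : ℕ) :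
    IsFiniteMeasure (convMPow α k) := by
  induction k with
  | zero => unfold convMPow; infer_instance
  | succ k ih => unfold convMPow; infer_instance

/-- The law at time `t` of the compound Poisson process with Lévy measure `α`. -/
def compoundPoisson (α : Measure ℝ) (t : ℝ) : Measure ℝ :=
  ENNReal.ofReal (Real.exp (-(t * α.real Set.univ))) •
    Measure.sum (fun k : ℕ => ENNReal.ofReal (t ^ k / k.factorial) • convMPow α k)

/-- The generator of the compound Poisson process with Lévy measure `α`. -/
def jumpOp (α : Measure ℝ) (g : ℝ → ℝ) (y : ℝ) : ℝ := ∫ w, (g (y + w) - g y) ∂α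

/-- The growth weight. -/
def weight (y : ℝ) : ℝ := 1 + Real.exp (2 * y)

lemma weight_pos (y : ℝ) : 0 < weight y := by unfold weight; positivity

lemma one_le_weight (y : ℝ) : 1 ≤ weight y := by
  unfold weight; linarith [Real.exp_pos (2 * y)]

@[fun_prop]
lemma continuous_weight : Continuous weight := by unfold weight; fun_prop

/-- The payoff grows like eʸ while the weight grows like e^{2y}; the gap is what later gives uniform
integrability. -/
lemma exp_le_weight (y : ℝ) : Real.exp y ≤ weight y := by
  unfold weight
  have : Real.exp (2 * y) = Real.exp y ^ 2 := by rw [← Real.exp_nat_mul]; norm_num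
  nlinarith [sq_nonneg (Real.exp y - 1), Real.exp_pos y]

lemma lintegral_compoundPoisson (α : Measure ℝ) (t : ℝ) (f : ℝ → ℝ≥0∞) :
    ∫⁻ x, f x ∂(compoundPoisson α t) = ENNReal.ofReal (Real.exp (-(t * α.real Set.univ))) *
      ∑' k : ℕ, ENNReal.ofReal (t ^ k / k.factorial) * ∫⁻ x, f x ∂(convMPow α k) := by
  unfold compoundPoisson
  rw [lintegral_smul_measure, lintegral_sum_measure]
  simp [lintegral_smul_measure]

lemma hasSum_integral_compoundPoisson (α : Measure ℝ) {F : Type*} [NormedAddCommGroup F] [NormedSpace ℝ F]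
    {t : ℝ} (ht : 0 ≤ t) {f : ℝ → F} (hf : Integrable f (compoundPoisson α t)) :
    HasSum (fun k : ℕ => Real.exp (-(t * α.real Set.univ)) •
        ((t ^ k / k.factorial) • ∫ x, f x ∂(convMPow α k)))
      (∫ x, f x ∂(compoundPoisson α t)) := by
  unfold compoundPoisson at hf ⊢
  rw [integral_smul_measure]
  rw [integrable_smul_measure (by simp [Real.exp_pos]) (by simp)] at hf
  have h := hasSum_integral_measure hf
  rw [ENNReal.toReal_ofReal (Real.exp_pos _).le]
  refine HasSum.const_smul _ ?_
  refine h.congr_fun ?_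
  intro k
  rw [integral_smul_measure, ENNReal.toReal_ofReal (by positivity)]

lemma hasSum_pow_div_factorial (x : ℝ) :
    HasSum (fun k : ℕ => x ^ k / k.factorial) (Real.exp x) := by
  rw [Real.exp_eq_exp_ℝ]; exact NormedSpace.expSeries_div_hasSum_exp x

section CompoundPoisson

variable (α : Measure ℝ) [IsFiniteMeasure α]

/-- A multiplicative E turns convolution into multiplication. With values in `ℝ≥0∞` no integrability
is needed, so integrability of exponentials is a consequence. -/
lemma lintegral_convMPow (E : ℝ → ℝ≥0∞) (hE : Measurable E) (h0 : E 0 = 1)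
    (hadd : ∀ x y, E (x + y) = E x * E y) (k : ℕ) :
    ∫⁻ x, E x ∂(convMPow α k) = (∫⁻ x, E x ∂α) ^ k := by
  induction k with
  | zero => simp [convMPow, lintegral_dirac' _ hE, h0]
  | succ k ih =>
    simp only [convMPow]
    rw [Measure.lintegral_conv hE]
    simp_rw [hadd]
    simp_rw [lintegral_const_mul _ hE]
    rw [lintegral_mul_const _ hE, ih, pow_succ]

lemma lintegral_exp_convMPow (θ : ℝ) (h : Integrable (fun x => Real.exp (θ * x)) α) (k : ℕ) :
    ∫⁻ x, ENNReal.ofReal (Real.exp (θ * x)) ∂(convMPow α k)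
      = ENNReal.ofReal ((∫ x, Real.exp (θ * x) ∂α) ^ k) := by
  rw [lintegral_convMPow α _ (by fun_prop) (by simp)]
  · rw [← ofReal_integral_eq_lintegral_ofReal h (ae_of_all _ fun x => (Real.exp_pos _).le),
      ENNReal.ofReal_pow (integral_nonneg fun x => (Real.exp_pos _).le)]
  · intro x y
    rw [mul_add, Real.exp_add, ENNReal.ofReal_mul (Real.exp_pos _).le]

lemma integrable_exp_convMPow (θ : ℝ) (h : Integrable (fun x => Real.exp (θ * x)) α) (k : ℕ) :
    Integrable (fun x => Real.exp (θ * x)) (convMPow α k) := by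
  refine ⟨by fun_prop, ?_⟩
  rw [hasFiniteIntegral_iff_ofReal (ae_of_all _ fun x => (Real.exp_pos _).le),
    lintegral_exp_convMPow α θ h k]
  exact ENNReal.ofReal_lt_top

lemma integral_exp_convMPow (θ : ℝ) (h : Integrable (fun x => Real.exp (θ * x)) α) (k : ℕ) :
    ∫ x, Real.exp (θ * x) ∂(convMPow α k) = (∫ x, Real.exp (θ * x) ∂α) ^ k := by
  rw [integral_eq_lintegral_of_nonneg_ae (ae_of_all _ fun x => (Real.exp_pos _).le) (by fun_prop),
    lintegral_exp_convMPow α θ h k, ENNReal.toReal_ofReal]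
  exact pow_nonneg (integral_nonneg fun x => (Real.exp_pos _).le) _

lemma lintegral_exp_compoundPoisson {t : ℝ} (ht : 0 ≤ t) (θ : ℝ)
    (h : Integrable (fun x => Real.exp (θ * x)) α) :
    ∫⁻ x, ENNReal.ofReal (Real.exp (θ * x)) ∂(compoundPoisson α t)
      = ENNReal.ofReal (Real.exp (t * ∫ x, (Real.exp (θ * x) - 1) ∂α)) := by
  rw [lintegral_compoundPoisson]
  simp_rw [lintegral_exp_convMPow α θ h]
  set m := ∫ x, Real.exp (θ * x) ∂α with hm
  have hm0 : 0 ≤ m := integral_nonneg fun x => (Real.exp_pos _).le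
  have hs := hasSum_pow_div_factorial (t * m)
  have h1 : ∀ k : ℕ, ENNReal.ofReal (t ^ k / k.factorial) * ENNReal.ofReal (m ^ k)
      = ENNReal.ofReal ((t * m) ^ k / k.factorial) := by
    intro k
    rw [← ENNReal.ofReal_mul (by positivity)]
    congr 1; rw [mul_pow]; ring
  simp_rw [h1]
  rw [← ENNReal.ofReal_tsum_of_nonneg (fun k => by positivity) hs.summable, hs.tsum_eq,
    ← ENNReal.ofReal_mul (Real.exp_pos _).le, ← Real.exp_add, integral_sub h (integrable_const 1)]
  congr 2
  simp [← hm]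
  ring

lemma isProbabilityMeasure_compoundPoisson {t : ℝ} (ht : 0 ≤ t) :
    IsProbabilityMeasure (compoundPoisson α t) := by
  refine ⟨?_⟩
  -- At θ = 0 the exponential moment is the total mass.
  have := lintegral_exp_compoundPoisson α ht 0 (by simp)
  simpa using this

lemma integrable_exp_compoundPoisson {t : ℝ} (ht : 0 ≤ t) (θ : ℝ)
    (h : Integrable (fun x => Real.exp (θ * x)) α) :
    Integrable (fun x => Real.exp (θ * x)) (compoundPoisson α t) := by
  refine ⟨by fun_prop, ?_⟩
  rw [hasFiniteIntegral_iff_ofReal (ae_of_all _ fun x => (Real.exp_pos _).le),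
    lintegral_exp_compoundPoisson α ht θ h]
  exact ENNReal.ofReal_lt_top

lemma integral_exp_compoundPoisson {t : ℝ} (ht : 0 ≤ t) (θ : ℝ)
    (h : Integrable (fun x => Real.exp (θ * x)) α) :
    ∫ x, Real.exp (θ * x) ∂(compoundPoisson α t)
      = Real.exp (t * ∫ x, (Real.exp (θ * x) - 1) ∂α) := by
  rw [integral_eq_lintegral_of_nonneg_ae (ae_of_all _ fun x => (Real.exp_pos _).le) (by fun_prop),
    lintegral_exp_compoundPoisson α ht θ h, ENNReal.toReal_ofReal (Real.exp_pos _).le]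

lemma charFun_convMPow (k : ℕ) (u : ℝ) : charFun (convMPow α k) u = charFun α u ^ k := by
  induction k with
  | zero => simp [convMPow]
  | succ k ih => simp only [convMPow]; rw [charFun_conv, ih, pow_succ]

lemma charFun_compoundPoisson {t : ℝ} (ht : 0 ≤ t) (u : ℝ) :
    charFun (compoundPoisson α t) u
      = Complex.exp (t * (charFun α u - (α.real Set.univ : ℂ))) := by
  have := isProbabilityMeasure_compoundPoisson α ht
  have hi : Integrable (fun x : ℝ => Complex.exp (u * x * Complex.I)) (compoundPoisson α t) := by
    refine Integrable.of_bound (C := 1) (by fun_prop) (ae_of_all _ fun x => ?_)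
    rw [← Complex.ofReal_mul, Complex.norm_exp_ofReal_mul_I]
  have h1 := hasSum_integral_compoundPoisson α ht hi
  simp_rw [← charFun_apply_real, charFun_convMPow] at h1
  refine h1.unique ?_
  rw [mul_sub, sub_eq_neg_add, Complex.exp_add]
  have h2 := NormedSpace.expSeries_div_hasSum_exp (t * charFun α u)
  rw [← Complex.exp_eq_exp_ℂ] at h2
  have h3 := h2.mul_left (Complex.exp (-(t * (α.real Set.univ : ℂ))))
  refine h3.congr_fun ?_
  intro k
  simp only [Complex.real_smul]
  push_cast
  rw [mul_pow]
  ring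

end CompoundPoisson

/-! ### Functions with exponentially bounded derivatives. -/

/-- `g` is `m` times differentiable and its derivatives up to order `m` are continuous and bounded
by `M * weight`. -/
def GrowthBound : ℕ → ℝ → (ℝ → ℝ) → Prop
  | 0, M, g => Continuous g ∧ ∀ y, |g y| ≤ M * weight y
  | m + 1, M, g => (∀ y, |g y| ≤ M * weight y) ∧ Differentiable ℝ g ∧ GrowthBound m M (deriv g)

lemma GrowthBound.bound {m : ℕ} {M : ℝ} {g : ℝ → ℝ} (h : GrowthBound m M g) (y : ℝ) :
    |g y| ≤ M * weight y := by
  cases m with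
  | zero => exact h.2 y
  | succ m => exact h.1 y

lemma GrowthBound.continuous {m : ℕ} {M : ℝ} {g : ℝ → ℝ} (h : GrowthBound m M g) :
    Continuous g := by
  cases m with
  | zero => exact h.1
  | succ m => exact h.2.1.continuous

lemma GrowthBound.zero {m : ℕ} {M : ℝ} {g : ℝ → ℝ} (h : GrowthBound m M g) :
    GrowthBound 0 M g := ⟨h.continuous, h.bound⟩

lemma integrable_weight {μ : Measure ℝ} [IsFiniteMeasure μ]
    (h : Integrable (fun x => Real.exp (2 * x)) μ) : Integrable weight μ :=
  (integrable_const 1).add h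

lemma GrowthBound.integrable {m : ℕ} {M : ℝ} {g : ℝ → ℝ} (hg : GrowthBound m M g)
    {μ : Measure ℝ} (h : Integrable weight μ) : Integrable g μ :=
  (h.const_mul M).mono' hg.continuous.aestronglyMeasurable (ae_of_all _ hg.bound)

lemma weight_add_le (y w : ℝ) : weight (y + w) ≤ weight y * weight w := by
  unfold weight
  rw [mul_add, Real.exp_add]
  nlinarith [Real.exp_pos (2 * y), Real.exp_pos (2 * w)]

lemma GrowthBound.integrable_shift {m : ℕ} {M : ℝ} {g : ℝ → ℝ} (hg : GrowthBound m M g)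
    {μ : Measure ℝ} (h : Integrable weight μ) (y : ℝ) : Integrable (fun w => g (y + w)) μ := by
  have hc := hg.continuous
  have hM : 0 ≤ M := by
    have := hg.bound 0
    have h2 := weight_pos 0
    by_contra hM
    nlinarith [abs_nonneg (g 0)]
  refine (h.const_mul (M * weight y)).mono' (by fun_prop) (ae_of_all _ fun w => ?_)
  refine (hg.bound _).trans ?_
  rw [mul_assoc]
  exact mul_le_mul_of_nonneg_left (weight_add_le y w) hM

/-! ### Taylor expansion in time for compound Poisson laws. -/

/-- Derivative of an exponential generating series. -/
lemma hasDerivAt_expSeries (a : ℕ → ℝ) (C R : ℝ) (hR : 0 ≤ R) (ha : ∀ k, |a k| ≤ C * R ^ k) (t : ℝ) :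
    HasDerivAt (fun t : ℝ => ∑' k : ℕ, t ^ k / k.factorial * a k)
      (∑' k : ℕ, t ^ k / k.factorial * a (k + 1)) t := by
  have hC : 0 ≤ C := by simpa using (abs_nonneg _).trans (ha 0)
  set ρ := |t| + 1 with hρ
  have hρ0 : 0 < ρ := by positivity
  set g' : ℕ → ℝ → ℝ := fun k t => (k : ℝ) * t ^ (k - 1) / k.factorial * a k with hg'
  have hsucc : ∀ (k : ℕ) (t : ℝ), g' (k + 1) t = t ^ k / k.factorial * a (k + 1) := by
    intro k t
    simp only [hg', Nat.factorial_succ, Nat.add_sub_cancel]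
    push_cast
    have : (k.factorial : ℝ) ≠ 0 := by positivity
    have : (k : ℝ) + 1 ≠ 0 := by positivity
    field_simp
  -- Summable majorant of the differentiated terms on the ball of radius |t| + 1, which contains
  -- both t and the base point 0.
  set u : ℕ → ℝ := fun k => (k : ℝ) * ρ ^ (k - 1) / k.factorial * (C * R ^ k) with hu
  have hus : Summable u := by
    rw [← summable_nat_add_iff 1]
    have : ∀ k, u (k + 1) = (C * R) * ((ρ * R) ^ k / k.factorial) := by
      intro k
      simp only [hu, Nat.factorial_succ, Nat.add_sub_cancel]
      push_cast
      have : (k.factorial : ℝ) ≠ 0 := by positivity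
      have : (k : ℝ) + 1 ≠ 0 := by positivity
      rw [mul_pow, pow_succ]
      field_simp
    simp_rw [this]
    exact (hasSum_pow_div_factorial _).summable.mul_left _
  have h := hasDerivAt_tsum_of_isPreconnected (t := Metric.ball (0 : ℝ) ρ) (y₀ := 0) (y := t)
    (g := fun k t => t ^ k / k.factorial * a k) (g' := g') hus Metric.isOpen_ball
    (convex_ball _ _).isPreconnected ?_ ?_ (by simpa using hρ0) ?_
    (by simp [hρ])
  · refine h.congr_deriv ?_
    rw [Summable.tsum_eq_zero_add]
    · simp_rw [hsucc]; simp [hg']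
    · refine Summable.of_norm_bounded hus fun k => ?_
      simp only [hg', hu, norm_mul, norm_div, norm_pow, Real.norm_eq_abs, Nat.abs_cast]
      gcongr
      · rw [hρ]; linarith
      · exact ha k
  · intro k y _
    simpa [hg'] using ((hasDerivAt_pow k y).div_const (k.factorial : ℝ)).mul_const (a k)
  · intro k y hy
    have hy' : |y| ≤ ρ := by simpa using (Metric.mem_ball.1 hy).le
    simp only [hg', hu, norm_mul, norm_div, norm_pow, Real.norm_eq_abs, Nat.abs_cast]
    gcongr
    exact ha k
  · refine summable_of_ne_finset_zero (s := {0}) fun k hk => ?_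
    simp at hk
    simp [hk]

section Taylor

variable (α : Measure ℝ) [IsFiniteMeasure α]

/-- The k-th convolution power integrates `weight` to a sum of two k-th powers. This geometric
growth is what allows termwise differentiation of the series. -/
lemma abs_integral_convMPow_le (hα : Integrable (fun x => Real.exp (2 * x)) α) {M : ℝ} {g : ℝ → ℝ}
    (hg : GrowthBound 0 M g) (k : ℕ) :
    |∫ x, g x ∂(convMPow α k)| ≤
      (2 * |M|) * (α.real Set.univ + ∫ x, Real.exp (2 * x) ∂α) ^ k := by
  have hw := integrable_weight (integrable_exp_convMPow α 2 hα k)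
  have h0 : α.real Set.univ ^ k = (convMPow α k).real Set.univ := by
    have := integral_exp_convMPow α 0 (by simp) k
    simpa using this.symm
  have hm : 0 ≤ ∫ x, Real.exp (2 * x) ∂α := integral_nonneg fun x => (Real.exp_pos _).le
  have h1 : ∫ x, weight x ∂(convMPow α k)
      = α.real Set.univ ^ k + (∫ x, Real.exp (2 * x) ∂α) ^ k := by
    unfold weight
    rw [integral_add (integrable_const _) (integrable_exp_convMPow α 2 hα k),
      integral_exp_convMPow α 2 hα k, h0]
    simp
  calc |∫ x, g x ∂(convMPow α k)| ≤ ∫ x, |g x| ∂(convMPow α k) := abs_integral_le_integral_abs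
    _ ≤ ∫ x, |M| * weight x ∂(convMPow α k) := by
        refine integral_mono (hg.integrable hw).abs (hw.const_mul _) fun x => ?_
        exact (hg.bound x).trans (mul_le_mul_of_nonneg_right (le_abs_self M) (weight_pos x).le)
    _ = |M| * (α.real Set.univ ^ k + (∫ x, Real.exp (2 * x) ∂α) ^ k) := by
        rw [integral_const_mul, h1]
    _ ≤ |M| * (2 * (α.real Set.univ + ∫ x, Real.exp (2 * x) ∂α) ^ k) := by
        have e1 : α.real Set.univ ^ k ≤ (α.real Set.univ + ∫ x, Real.exp (2 * x) ∂α) ^ k := by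
          gcongr; linarith
        have e2 : (∫ x, Real.exp (2 * x) ∂α) ^ k
            ≤ (α.real Set.univ + ∫ x, Real.exp (2 * x) ∂α) ^ k := by
          gcongr; linarith [measureReal_nonneg (μ := α) (s := Set.univ)]
        gcongr; linarith
    _ = _ := by ring

/-- One more convolution by α averages g over one more jump. The resulting difference is exactly
what differentiating the series and its normalising exponential produces. -/
lemma integral_jumpOp_convMPow (hα : Integrable (fun x => Real.exp (2 * x)) α) {M M' : ℝ}
    {g : ℝ → ℝ} (hg : GrowthBound 0 M g) (hg' : GrowthBound 0 M' (jumpOp α g)) (k : ℕ) :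
    ∫ x, jumpOp α g x ∂(convMPow α k)
      = ∫ x, g x ∂(convMPow α (k + 1)) - α.real Set.univ * ∫ x, g x ∂(convMPow α k) := by
  have hw := fun k => integrable_weight (integrable_exp_convMPow α 2 hα k)
  have h1 : ∫ x, g x ∂(convMPow α (k + 1)) = ∫ y, ∫ w, g (y + w) ∂α ∂(convMPow α k) := by
    have := hg.integrable (hw (k + 1))
    rw [show convMPow α (k + 1) = Measure.conv (convMPow α k) α from rfl] at this ⊢
    exact integral_conv this
  have h2 : ∀ y, ∫ w, g (y + w) ∂α = jumpOp α g y + α.real Set.univ * g y := by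
    intro y
    unfold jumpOp
    rw [integral_sub (hg.integrable_shift (integrable_weight hα) y) (integrable_const _)]
    simp
  rw [h1]
  simp_rw [h2]
  rw [integral_add (hg'.integrable (hw k)) ((hg.integrable (hw k)).const_mul _),
    integral_const_mul]
  ring

/-- `∫ g dπ_t` as an explicit series, for all real `t`. -/
def cpSeries (g : ℝ → ℝ) (t : ℝ) : ℝ :=
  Real.exp (-(t * α.real Set.univ)) *
    ∑' k : ℕ, t ^ k / k.factorial * ∫ x, g x ∂(convMPow α k)

lemma integral_compoundPoisson_eq_cpSeries (hα : Integrable (fun x => Real.exp (2 * x)) α) {M : ℝ}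
    {g : ℝ → ℝ} (hg : GrowthBound 0 M g) {t : ℝ} (ht : 0 ≤ t) :
    ∫ x, g x ∂(compoundPoisson α t) = cpSeries α g t := by
  have := isProbabilityMeasure_compoundPoisson α ht
  have hi := hg.integrable (integrable_weight (integrable_exp_compoundPoisson α ht 2 hα))
  rw [← (hasSum_integral_compoundPoisson α ht hi).tsum_eq, cpSeries, tsum_const_smul'']
  simp

/-- Kolmogorov's equation: the shifted series minus the total mass times the series is the series of
`jumpOp α g`. It holds at every real t, so no one-sided derivative at 0 is needed. -/
lemma hasDerivAt_cpSeries (hα : Integrable (fun x => Real.exp (2 * x)) α) {M M' : ℝ}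
    {g : ℝ → ℝ} (hg : GrowthBound 0 M g) (hg' : GrowthBound 0 M' (jumpOp α g)) (t : ℝ) :
    HasDerivAt (cpSeries α g) (cpSeries α (jumpOp α g) t) t := by
  set R := α.real Set.univ + ∫ x, Real.exp (2 * x) ∂α with hRdef
  have hR : 0 ≤ R := by
    have : 0 ≤ ∫ x, Real.exp (2 * x) ∂α := integral_nonneg fun x => (Real.exp_pos _).le
    positivity
  have hb := fun k => abs_integral_convMPow_le α hα hg k
  have hd := hasDerivAt_expSeries (fun k => ∫ x, g x ∂(convMPow α k)) _ R hR hb t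
  have he : HasDerivAt (fun t => Real.exp (-(t * α.real Set.univ)))
      (-(α.real Set.univ) * Real.exp (-(t * α.real Set.univ))) t := by
    have := ((hasDerivAt_id t).mul_const (α.real Set.univ)).fun_neg.exp
    refine this.congr_deriv ?_
    simp only [id]
    ring
  have hsum : ∀ b : ℕ → ℝ, (∃ C, ∀ k, |b k| ≤ C * R ^ k) →
      Summable fun k : ℕ => t ^ k / k.factorial * b k := by
    rintro b ⟨C, hC⟩
    refine Summable.of_norm_bounded
      (((hasSum_pow_div_factorial (|t| * R)).summable).mul_left C) fun k => ?_
    simp only [norm_mul, norm_div, norm_pow, Real.norm_eq_abs, Nat.abs_cast]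
    calc |t| ^ k / k.factorial * |b k| ≤ |t| ^ k / k.factorial * (C * R ^ k) := by
          gcongr; exact hC k
      _ = C * ((|t| * R) ^ k / k.factorial) := by rw [mul_pow]; ring
  have hs0 := hsum _ ⟨_, hb⟩
  have hs1 : Summable fun k : ℕ => t ^ k / k.factorial * ∫ x, g x ∂(convMPow α (k + 1)) := by
    refine hsum _ ⟨2 * |M| * R, fun k => (hb (k + 1)).trans (le_of_eq ?_)⟩
    rw [pow_succ]; ring
  have hprod := he.mul hd
  refine hprod.congr_deriv ?_
  unfold cpSeries
  simp_rw [integral_jumpOp_convMPow α hα hg hg', mul_sub]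
  rw [Summable.tsum_sub hs1 (by simpa [mul_left_comm] using hs0.mul_left (α.real Set.univ))]
  have : ∀ k : ℕ, t ^ k / k.factorial * (α.real Set.univ * ∫ x, g x ∂(convMPow α k))
      = α.real Set.univ * (t ^ k / k.factorial * ∫ x, g x ∂(convMPow α k)) := fun k => by ring
  simp_rw [this, tsum_mul_left]
  ring

/-- Taylor expansion in time of the compound Poisson semigroup. -/
theorem abs_integral_compoundPoisson_sub_le (hα : Integrable (fun x => Real.exp (2 * x)) α)
    {B : ℝ} (N : ℕ) (g : ℝ → ℝ) (hg : ∀ j ≤ N, ∃ M, GrowthBound 0 M ((jumpOp α)^[j] g))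
    (hB : ∀ r, 0 ≤ r → r ≤ 1 → |∫ x, (jumpOp α)^[N] g x ∂(compoundPoisson α r)| ≤ B)
    {t : ℝ} (ht : 0 ≤ t) (ht1 : t ≤ 1) :
    |∫ x, g x ∂(compoundPoisson α t)
      - ∑ j ∈ Finset.range N, t ^ j / j.factorial * (jumpOp α)^[j] g 0| ≤ B * t ^ N := by
  induction N generalizing g t with
  | zero => simpa using hB t ht ht1
  | succ N ih =>
    obtain ⟨M, hM⟩ := hg 0 (by omega)
    obtain ⟨M', hM'⟩ := hg 1 (by omega)
    have hM : GrowthBound 0 M g := hM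
    have hM' : GrowthBound 0 M' (jumpOp α g) := hM'
    -- The time derivative of the order N + 1 remainder for g is the order N remainder for `jumpOp α
    -- g`, and both have the same top iterate, hence the same B.
    have ih' := fun {t : ℝ} => ih (jumpOp α g) (fun j hj => hg (j + 1) (by omega)) hB (t := t)
    set D : ℝ → ℝ := fun t => cpSeries α g t
      - ∑ j ∈ Finset.range (N + 1), t ^ j / j.factorial * (jumpOp α)^[j] g 0 with hD
    have hB0 : 0 ≤ B := (abs_nonneg _).trans (hB 0 le_rfl zero_le_one)
    have hpoly : ∀ r : ℝ, HasDerivAt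
        (fun t : ℝ => ∑ j ∈ Finset.range (N + 1), t ^ j / j.factorial * (jumpOp α)^[j] g 0)
        (∑ j ∈ Finset.range N, r ^ j / j.factorial * (jumpOp α)^[j] (jumpOp α g) 0) r := by
      intro r
      have h1 := HasDerivAt.fun_sum (u := Finset.range (N + 1)) fun j _ =>
        ((hasDerivAt_pow j r).div_const (j.factorial : ℝ)).mul_const ((jumpOp α)^[j] g 0)
      refine h1.congr_deriv ?_
      rw [Finset.sum_range_succ']
      simp only [Nat.factorial_succ, Nat.add_sub_cancel, Function.iterate_succ_apply]
      simp only [CharP.cast_eq_zero, zero_mul, zero_div, add_zero]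
      refine Finset.sum_congr rfl fun j _ => ?_
      push_cast
      have : (j.factorial : ℝ) ≠ 0 := by positivity
      have : (j : ℝ) + 1 ≠ 0 := by positivity
      field_simp
    have hderiv : ∀ r, HasDerivAt D (cpSeries α (jumpOp α g) r
        - ∑ j ∈ Finset.range N, r ^ j / j.factorial * (jumpOp α)^[j] (jumpOp α g) 0) r :=
      fun r => (hasDerivAt_cpSeries α hα hM hM' r).sub (hpoly r)
    have hD0 : D 0 = 0 := by
      have h1 : cpSeries α g 0 = g 0 := by
        unfold cpSeries
        rw [tsum_eq_single 0]
        · simp [convMPow]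
        · intro k hk; simp [hk]
      simp only [hD, h1]
      rw [Finset.sum_range_succ']
      simp
    -- The mean value inequality with slope B tᴺ on [0, t] costs one factor t; the factorial gain of
    -- the exact Taylor remainder is given up.
    have hmv := norm_image_sub_le_of_norm_deriv_le_segment' (a := 0) (b := t) (f := D)
      (C := B * t ^ N) (fun r _ => (hderiv r).hasDerivWithinAt) ?_ t ⟨ht, le_rfl⟩
    · rw [hD0, sub_zero, sub_zero] at hmv
      rw [integral_compoundPoisson_eq_cpSeries α hα hM ht]
      refine hmv.trans (le_of_eq ?_)
      rw [pow_succ]; ring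
    · intro r hr
      have := ih' hr.1 (hr.2.le.trans ht1)
      rw [integral_compoundPoisson_eq_cpSeries α hα hM' hr.1] at this
      refine this.trans ?_
      have hr0 := hr.1
      gcongr
      exact hr.2.le

end Taylor

/-! ### Stability of growth bounds and Taylor estimates in space. -/

lemma GrowthBound.nonneg {m : ℕ} {M : ℝ} {g : ℝ → ℝ} (h : GrowthBound m M g) : 0 ≤ M := by
  by_contra hM
  nlinarith [abs_nonneg (g 0), h.bound 0, weight_pos 0]

lemma GrowthBound.pred {m : ℕ} {M : ℝ} {g : ℝ → ℝ} (h : GrowthBound (m + 1) M g) :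
    GrowthBound m M g := by
  induction m generalizing g with
  | zero => exact h.zero
  | succ m ih => exact ⟨h.1, h.2.1, ih h.2.2⟩

lemma GrowthBound.of_le {m m' : ℕ} {M : ℝ} {g : ℝ → ℝ} (h : GrowthBound m M g) (hm : m' ≤ m) :
    GrowthBound m' M g := by
  induction hm with
  | refl => exact h
  | step _ ih => exact ih h.pred

lemma GrowthBound.mono {m : ℕ} {M M' : ℝ} {g : ℝ → ℝ} (h : GrowthBound m M g) (hM : M ≤ M') :
    GrowthBound m M' g := by
  have hb : ∀ y, |g y| ≤ M' * weight y := fun y =>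
    (h.bound y).trans (mul_le_mul_of_nonneg_right hM (weight_pos y).le)
  induction m generalizing g with
  | zero => exact ⟨h.1, hb⟩
  | succ m ih =>
    exact ⟨hb, h.2.1, ih h.2.2 fun y =>
      (h.2.2.bound y).trans (mul_le_mul_of_nonneg_right hM (weight_pos y).le)⟩

lemma GrowthBound.deriv {m : ℕ} {M : ℝ} {g : ℝ → ℝ} (h : GrowthBound (m + 1) M g) :
    GrowthBound m M (deriv g) := h.2.2

lemma GrowthBound.hasDerivAt {m : ℕ} {M : ℝ} {g : ℝ → ℝ} (h : GrowthBound (m + 1) M g) (y : ℝ) :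
    HasDerivAt g (_root_.deriv g y) y := (h.2.1 y).hasDerivAt

lemma GrowthBound.succ_of_hasDerivAt {m : ℕ} {M : ℝ} {g g' : ℝ → ℝ}
    (hb : ∀ y, |g y| ≤ M * weight y) (hd : ∀ y, HasDerivAt g (g' y) y) (h : GrowthBound m M g') :
    GrowthBound (m + 1) M g :=
  ⟨hb, fun y => (hd y).differentiableAt, by
    rwa [show _root_.deriv g = g' from funext fun y => (hd y).deriv]⟩

lemma GrowthBound.add {m : ℕ} {M M' : ℝ} {g f : ℝ → ℝ} (hg : GrowthBound m M g)
    (hf : GrowthBound m M' f) : GrowthBound m (M + M') (fun y => g y + f y) := by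
  have hb : ∀ y, |g y + f y| ≤ (M + M') * weight y := fun y => by
    rw [add_mul]
    exact (abs_add_le _ _).trans (add_le_add (hg.bound y) (hf.bound y))
  induction m generalizing g f with
  | zero => exact ⟨hg.1.add hf.1, hb⟩
  | succ m ih =>
    refine succ_of_hasDerivAt hb (fun y => (hg.hasDerivAt y).add (hf.hasDerivAt y))
      (ih hg.deriv hf.deriv fun y => ?_)
    rw [add_mul]
    exact (abs_add_le _ _).trans (add_le_add (hg.deriv.bound y) (hf.deriv.bound y))

lemma GrowthBound.const_mul {m : ℕ} {M : ℝ} {g : ℝ → ℝ} (hg : GrowthBound m M g) (a : ℝ) :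
    GrowthBound m (|a| * M) (fun y => a * g y) := by
  have hb : ∀ y, |a * g y| ≤ (|a| * M) * weight y := fun y => by
    rw [abs_mul, mul_assoc]
    exact mul_le_mul_of_nonneg_left (hg.bound y) (abs_nonneg a)
  induction m generalizing g with
  | zero => exact ⟨hg.1.const_mul a, hb⟩
  | succ m ih =>
    refine succ_of_hasDerivAt hb (fun y => (hg.hasDerivAt y).const_mul a) (ih hg.deriv fun y => ?_)
    rw [abs_mul, mul_assoc]
    exact mul_le_mul_of_nonneg_left (hg.deriv.bound y) (abs_nonneg a)

lemma GrowthBound.sub {m : ℕ} {M M' : ℝ} {g f : ℝ → ℝ} (hg : GrowthBound m M g)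
    (hf : GrowthBound m M' f) : GrowthBound m (M + M') (fun y => g y - f y) := by
  simpa [sub_eq_add_neg] using hg.add (hf.const_mul (-1))

lemma weight_add_le_exp {y r : ℝ} (hr : |r| ≤ 1) : weight (y + r) ≤ Real.exp 2 * weight y := by
  unfold weight
  have h1 : Real.exp (2 * (y + r)) ≤ Real.exp 2 * Real.exp (2 * y) := by
    rw [← Real.exp_add]
    exact Real.exp_le_exp.2 (by linarith [(abs_le.1 hr).2])
  have h2 : (1 : ℝ) ≤ Real.exp 2 := Real.one_le_exp (by norm_num)
  nlinarith

lemma GrowthBound.bound_shift {m : ℕ} {M : ℝ} {g : ℝ → ℝ} (h : GrowthBound m M g) {y r : ℝ}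
    (hr : |r| ≤ 1) : |g (y + r)| ≤ Real.exp 2 * M * weight y := by
  refine (h.bound _).trans ?_
  nlinarith [mul_le_mul_of_nonneg_left (weight_add_le_exp (y := y) hr) h.nonneg]

/-- Mean value inequality from 0. Each Taylor remainder below, as a function of z, vanishes at 0 and
has as derivative the previous remainder for g', so this step is repeated. -/
lemma abs_le_of_hasDerivAt_of_le {f f' : ℝ → ℝ} {C z : ℝ} (h0 : f 0 = 0)
    (hd : ∀ v, HasDerivAt f (f' v) v) (hb : ∀ v, |v| ≤ |z| → |f' v| ≤ C) : |f z| ≤ |z| * C := by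
  have := Convex.norm_image_sub_le_of_norm_hasDerivWithin_le (f := f) (f' := f') (C := C)
    (s := Set.Icc (-|z|) |z|) (x := 0) (y := z) (fun v _ => (hd v).hasDerivWithinAt)
    (fun v hv => hb v (abs_le.2 hv)) (convex_Icc _ _) (by simp)
    ⟨neg_abs_le z, le_abs_self z⟩
  rw [h0, sub_zero, sub_zero, mul_comm] at this
  exact this

lemma GrowthBound.abs_sub_le {m : ℕ} {M : ℝ} {g : ℝ → ℝ} (h : GrowthBound (m + 1) M g) {y z : ℝ}
    (hz : |z| ≤ 1) : |g (y + z) - g y| ≤ |z| * (Real.exp 2 * M * weight y) :=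
  abs_le_of_hasDerivAt_of_le (f := fun z => g (y + z) - g y) (by simp)
    (fun v => ((h.hasDerivAt (y + v)).comp_const_add y v).sub_const _)
    fun _ hv => h.deriv.bound_shift (hv.trans hz)

lemma GrowthBound.abs_taylor_two_le {m : ℕ} {M : ℝ} {g : ℝ → ℝ} (h : GrowthBound (m + 2) M g)
    {y z : ℝ} (hz : |z| ≤ 1) :
    |g (y + z) - g y - z * _root_.deriv g y| ≤ z ^ 2 * (Real.exp 2 * M * weight y) := by
  have hK : 0 ≤ Real.exp 2 * M * weight y := by
    have := h.nonneg; have := weight_pos y; positivity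
  refine (abs_le_of_hasDerivAt_of_le (f := fun z => g (y + z) - g y - z * _root_.deriv g y)
    (C := |z| * (Real.exp 2 * M * weight y)) (by simp)
    (fun v => (((h.hasDerivAt (y + v)).comp_const_add y v).sub_const _).sub
      ((hasDerivAt_id v).mul_const _)) fun v hv => ?_).trans (le_of_eq ?_)
  · rw [one_mul]
    exact (h.deriv.abs_sub_le (hv.trans hz)).trans (mul_le_mul_of_nonneg_right hv hK)
  · rw [← mul_assoc, abs_mul_abs_self, sq]

lemma GrowthBound.abs_taylor_three_le {m : ℕ} {M : ℝ} {g : ℝ → ℝ} (h : GrowthBound (m + 3) M g)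
    {y z : ℝ} (hz : |z| ≤ 1) :
    |g (y + z) - g y - z * _root_.deriv g y - z ^ 2 / 2 * _root_.deriv (_root_.deriv g) y|
      ≤ |z| ^ 3 * (Real.exp 2 * M * weight y) := by
  have hK : 0 ≤ Real.exp 2 * M * weight y := by
    have := h.nonneg; have := weight_pos y; positivity
  refine (abs_le_of_hasDerivAt_of_le
    (f := fun z => g (y + z) - g y - z * _root_.deriv g y
      - z ^ 2 / 2 * _root_.deriv (_root_.deriv g) y)
    (f' := fun z => _root_.deriv g (y + z) - _root_.deriv g y
      - z * _root_.deriv (_root_.deriv g) y)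
    (C := z ^ 2 * (Real.exp 2 * M * weight y)) (by simp)
    (fun v => ?_) fun v hv => ?_).trans (le_of_eq ?_)
  · have h1 := ((((h.hasDerivAt (y + v)).comp_const_add y v).sub_const (g y)).sub
      ((hasDerivAt_id v).mul_const (_root_.deriv g y))).sub
      (((hasDerivAt_pow 2 v).div_const 2).mul_const (_root_.deriv (_root_.deriv g) y))
    refine h1.congr_deriv ?_
    simp
  · exact (h.deriv.abs_taylor_two_le (hv.trans hz)).trans
      (mul_le_mul_of_nonneg_right (sq_le_sq.2 hv) hK)
  · rw [← sq_abs z]; ring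

/-! ### Generators with bounded jumps. -/

/-- The compensated jump operator `g ↦ ∫ (g(y+z) - g(y) - z g'(y)) κ(dz)`. -/
def taylorOp (κ : Measure ℝ) (g : ℝ → ℝ) (y : ℝ) : ℝ := ∫ z, (g (y + z) - g y - z * deriv g y) ∂κ

/-- The generator `a g' + q g'' + ∫ (g(· + z) - g - z g') κ(dz)`. -/
def levyOp (a q : ℝ) (κ : Measure ℝ) (g : ℝ → ℝ) (y : ℝ) : ℝ :=
  a * deriv g y + q * deriv (deriv g) y + taylorOp κ g y

/-- `κ` lives on `[-1, 1]` and integrates `z²`. -/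
def IsSmallJump (κ : Measure ℝ) : Prop := (∀ᵐ z ∂κ, |z| ≤ 1) ∧ Integrable (fun z => z ^ 2) κ

section LevyOp

variable {κ : Measure ℝ}

lemma IsSmallJump.integrable_taylor (hκ : IsSmallJump κ) {m : ℕ} {M : ℝ} {g : ℝ → ℝ} (h : GrowthBound (m + 2) M g)
    (y : ℝ) : Integrable (fun z => g (y + z) - g y - z * deriv g y) κ := by
  have hc := h.continuous
  refine (hκ.2.mul_const (Real.exp 2 * M * weight y)).mono' (by fun_prop) ?_
  filter_upwards [hκ.1] with z hz using h.abs_taylor_two_le hz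

lemma IsSmallJump.abs_taylorOp_le (hκ : IsSmallJump κ) {m : ℕ} {M : ℝ} {g : ℝ → ℝ} (h : GrowthBound (m + 2) M g)
    (y : ℝ) : |taylorOp κ g y| ≤ (Real.exp 2 * ∫ z, z ^ 2 ∂κ) * M * weight y := by
  unfold taylorOp
  rw [← Real.norm_eq_abs]
  refine (norm_integral_le_of_norm_le (hκ.2.mul_const (Real.exp 2 * M * weight y)) ?_).trans ?_
  · filter_upwards [hκ.1] with z hz using h.abs_taylor_two_le hz
  · rw [integral_mul_const]
    exact le_of_eq (by ring)

/-- The operator commutes with differentiation: near y the derivative of the integrand is the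
second-order remainder of g', dominated by a multiple of z², which κ integrates. -/
lemma IsSmallJump.hasDerivAt_taylorOp (hκ : IsSmallJump κ) {m : ℕ} {M : ℝ} {g : ℝ → ℝ} (h : GrowthBound (m + 3) M g)
    (y : ℝ) : HasDerivAt (taylorOp κ g) (taylorOp κ (deriv g) y) y := by
  have hM := h.nonneg
  have hc := h.continuous
  have hc' := h.deriv.continuous
  have key := hasDerivAt_integral_of_dominated_loc_of_deriv_le (μ := κ) (𝕜 := ℝ)
    (F := fun x z => g (x + z) - g x - z * deriv g x)
    (F' := fun x z => deriv g (x + z) - deriv g x - z * deriv (deriv g) x)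
    (bound := fun z => z ^ 2 * (Real.exp 2 * M * (Real.exp 2 * weight y)))
    (s := Metric.closedBall y 1) (x₀ := y) (Metric.closedBall_mem_nhds y one_pos)
    (Eventually.of_forall fun x => by fun_prop) (hκ.integrable_taylor h y) (by fun_prop)
    ?_ (hκ.2.mul_const _) ?_
  · exact key.2
  · filter_upwards [hκ.1] with z hz x hx
    refine (h.deriv.abs_taylor_two_le hz).trans ?_
    have hx' : |x - y| ≤ 1 := by simpa [Real.dist_eq] using hx
    have : weight x ≤ Real.exp 2 * weight y := by
      simpa using weight_add_le_exp (y := y) hx'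
    gcongr
  · refine ae_of_all _ fun z x _ => ?_
    exact (((h.hasDerivAt (x + z)).comp_add_const x z).sub (h.hasDerivAt x)).sub
      ((h.deriv.hasDerivAt x).const_mul z)

/-- Two derivatives are spent on the z² bound; the third yields continuity through
differentiability. This is the origin of the factor 3 in later orders such as `3 * j`. -/
lemma IsSmallJump.growthBound_taylorOp (hκ : IsSmallJump κ) {m : ℕ} {M : ℝ} {g : ℝ → ℝ} (h : GrowthBound (m + 3) M g) :
    GrowthBound m (Real.exp 2 * (∫ z, z ^ 2 ∂κ) * M) (taylorOp κ g) := by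
  induction m generalizing g with
  | zero =>
    refine ⟨?_, hκ.abs_taylorOp_le (m := 1) h⟩
    exact continuous_iff_continuousAt.2 fun y => (hκ.hasDerivAt_taylorOp h y).continuousAt
  | succ m ih =>
    exact GrowthBound.succ_of_hasDerivAt (hκ.abs_taylorOp_le (m := m + 2) h)
      (hκ.hasDerivAt_taylorOp (m := m + 1) h) (ih h.deriv)

lemma IsSmallJump.hasDerivAt_levyOp (hκ : IsSmallJump κ) (a q : ℝ) {m : ℕ} {M : ℝ} {g : ℝ → ℝ}
    (h : GrowthBound (m + 3) M g) (y : ℝ) :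
    HasDerivAt (levyOp a q κ g) (levyOp a q κ (deriv g) y) y :=
  (((h.deriv.hasDerivAt y).const_mul a).add ((h.deriv.deriv.hasDerivAt y).const_mul q)).add
    (hκ.hasDerivAt_taylorOp h y)

lemma IsSmallJump.growthBound_levyOp (hκ : IsSmallJump κ) (a q : ℝ) {m : ℕ} {M : ℝ} {g : ℝ → ℝ}
    (h : GrowthBound (m + 3) M g) :
    GrowthBound m ((|a| + |q| + Real.exp 2 * ∫ z, z ^ 2 ∂κ) * M) (levyOp a q κ g) := by
  have h1 := ((h.deriv.of_le (m' := m) (by omega)).const_mul a).add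
    ((h.deriv.deriv.of_le (m' := m) (by omega)).const_mul q)
  refine (h1.add (hκ.growthBound_taylorOp h)).mono (le_of_eq ?_)
  ring

lemma IsSmallJump.growthBound_iterate_levyOp (hκ : IsSmallJump κ) {a q K : ℝ}
    (hK : |a| + |q| + Real.exp 2 * ∫ z, z ^ 2 ∂κ ≤ K) (j : ℕ) {m : ℕ} {M : ℝ} {g : ℝ → ℝ}
    (h : GrowthBound (m + 3 * j) M g) :
    GrowthBound m (K ^ j * M) ((levyOp a q κ)^[j] g) := by
  induction j generalizing m with
  | zero => simpa using h
  | succ j ih =>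
    rw [Function.iterate_succ_apply']
    have h1 := ih (m := m + 3) (h.of_le (by omega))
    refine (hκ.growthBound_levyOp a q h1).mono ?_
    rw [pow_succ', mul_assoc]
    exact mul_le_mul_of_nonneg_right hK h1.nonneg

lemma IsSmallJump.levyOp_sub (hκ : IsSmallJump κ) (a q : ℝ) {m m' : ℕ} {M M' : ℝ} {f g : ℝ → ℝ}
    (hf : GrowthBound (m + 2) M f) (hg : GrowthBound (m' + 2) M' g) (y : ℝ) :
    levyOp a q κ (fun y => f y - g y) y = levyOp a q κ f y - levyOp a q κ g y := by
  have h1 : deriv (fun y => f y - g y) = fun y => deriv f y - deriv g y :=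
    funext fun y => ((hf.hasDerivAt y).sub (hg.hasDerivAt y)).deriv
  have h2 : deriv (deriv (fun y => f y - g y)) y = deriv (deriv f) y - deriv (deriv g) y := by
    rw [h1]
    exact ((hf.deriv.hasDerivAt y).sub (hg.deriv.hasDerivAt y)).deriv
  unfold levyOp taylorOp
  rw [h2, h1]
  have h3 : ∀ z, (f (y + z) - g (y + z)) - (f y - g y) - z * (deriv f y - deriv g y)
      = (f (y + z) - f y - z * deriv f y) - (g (y + z) - g y - z * deriv g y) := fun z => by ring
  simp_rw [h3]
  rw [integral_sub (hκ.integrable_taylor hf y) (hκ.integrable_taylor hg y)]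
  ring

end LevyOp

/-! ### Approximation of the generator by finite jump measures. -/

/-- The jumps of `κ` of size larger than `h`. -/
def cutMeasure (κ : Measure ℝ) (h : ℝ) : Measure ℝ := κ.restrict {z | h < |z|}

/-- Rate of the jumps of size `h` in `approxMeasure`. -/
def rateUp (a q : ℝ) (κ : Measure ℝ) (h : ℝ) : ℝ :=
  max a 0 / h + q / h ^ 2 + (∫ z, max (-z) 0 ∂(cutMeasure κ h)) / h

/-- Rate of the jumps of size `-h` in `approxMeasure`. -/
def rateDown (a q : ℝ) (κ : Measure ℝ) (h : ℝ) : ℝ :=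
  max (-a) 0 / h + q / h ^ 2 + (∫ z, max z 0 ∂(cutMeasure κ h)) / h

/-- A finite jump measure whose compound Poisson generator approximates `levyOp a q κ`. -/
def approxMeasure (a q : ℝ) (κ : Measure ℝ) (h : ℝ) : Measure ℝ :=
  ENNReal.ofReal (rateUp a q κ h) • Measure.dirac h
    + ENNReal.ofReal (rateDown a q κ h) • Measure.dirac (-h) + cutMeasure κ h

lemma measurableSet_cut (h : ℝ) : MeasurableSet {z : ℝ | h < |z|} :=
  measurableSet_lt measurable_const (by fun_prop)

section Approx

variable {κ : Measure ℝ}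

lemma IsSmallJump.sq_nonneg_integral (κ : Measure ℝ) : 0 ≤ ∫ z, z ^ 2 ∂κ :=
  integral_nonneg fun z => sq_nonneg z

lemma IsSmallJump.isFiniteMeasure_cut (hκ : IsSmallJump κ) {h : ℝ} (hh : 0 < h) :
    IsFiniteMeasure (cutMeasure κ h) := by
  refine ⟨?_⟩
  rw [cutMeasure, Measure.restrict_apply_univ]
  have hi : ∫⁻ z, ENNReal.ofReal (z ^ 2) ∂κ < ⊤ := by
    rw [← hasFiniteIntegral_iff_ofReal (ae_of_all _ fun z => sq_nonneg z)]
    exact hκ.2.2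
  have h0 : ENNReal.ofReal (h ^ 2) ≠ 0 := by simp; positivity
  refine (measure_mono (t := {z | ENNReal.ofReal (h ^ 2) ≤ ENNReal.ofReal (z ^ 2)}) ?_).trans_lt
    ((meas_ge_le_lintegral_div (by fun_prop) h0 (by simp)).trans_lt
      (ENNReal.div_lt_top hi.ne h0))
  intro z hz
  refine ENNReal.ofReal_le_ofReal (sq_le_sq.2 ?_)
  rw [abs_of_pos hh]; exact le_of_lt hz

lemma IsSmallJump.ae_cut (hκ : IsSmallJump κ) (h : ℝ) :
    ∀ᵐ z ∂(cutMeasure κ h), |z| ≤ 1 ∧ h < |z| := by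
  rw [cutMeasure]
  filter_upwards [ae_restrict_of_ae hκ.1, ae_restrict_mem (measurableSet_cut h)] with z h1 h2
    using ⟨h1, h2⟩

lemma IsSmallJump.integrable_cut (hκ : IsSmallJump κ) {h : ℝ} (hh : 0 < h) {f : ℝ → ℝ}
    (hf : Continuous f) : Integrable f (cutMeasure κ h) := by
  have := hκ.isFiniteMeasure_cut hh
  obtain ⟨C, hC⟩ := (isCompact_Icc (a := (-1 : ℝ)) (b := 1)).exists_bound_of_continuousOn
    hf.continuousOn
  refine Integrable.of_bound hf.aestronglyMeasurable C ?_
  filter_upwards [hκ.ae_cut h] with z hz using hC z (abs_le.1 hz.1)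

lemma rateUp_nonneg {a q h : ℝ} (hq : 0 ≤ q) (hh : 0 < h) : 0 ≤ rateUp a q κ h := by
  have : 0 ≤ ∫ z, max (-z) 0 ∂(cutMeasure κ h) := integral_nonneg fun z => le_max_right _ _
  have : 0 ≤ max a 0 := le_max_right _ _
  unfold rateUp; positivity

lemma rateDown_nonneg {a q h : ℝ} (hq : 0 ≤ q) (hh : 0 < h) : 0 ≤ rateDown a q κ h := by
  have : 0 ≤ ∫ z, max z 0 ∂(cutMeasure κ h) := integral_nonneg fun z => le_max_right _ _
  have : 0 ≤ max (-a) 0 := le_max_right _ _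
  unfold rateDown; positivity

/-- The mean is exactly a: the symmetric q/h² cancels, a⁺ and a⁻ give the drift, and the last terms
of the rates offset the mean of the retained jumps with nonnegative rates only. -/
lemma IsSmallJump.rate_sub (hκ : IsSmallJump κ) (a q : ℝ) {h : ℝ} (hh : 0 < h) :
    (rateUp a q κ h - rateDown a q κ h) * h + ∫ z, z ∂(cutMeasure κ h) = a := by
  have h1 : ∫ z, z ∂(cutMeasure κ h)
      = ∫ z, max z 0 ∂(cutMeasure κ h) - ∫ z, max (-z) 0 ∂(cutMeasure κ h) := by
    rw [← integral_sub (hκ.integrable_cut hh (by fun_prop)) (hκ.integrable_cut hh (by fun_prop))]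
    refine integral_congr_ae (ae_of_all _ fun z => ?_)
    rcases le_total z 0 with hz | hz <;> simp [hz]
  have h2 : max a 0 - max (-a) 0 = a := by
    rcases le_total a 0 with hz | hz <;> simp [hz]
  rw [h1]
  unfold rateUp rateDown
  field_simp
  linear_combination h * h2

/-- The second moment of the ±h jumps: the 2q survives as h → 0 and becomes the diffusion, the other
two terms are errors. -/
lemma IsSmallJump.rate_add (hκ : IsSmallJump κ) (a q : ℝ) {h : ℝ} (hh : 0 < h) :
    (rateUp a q κ h + rateDown a q κ h) * h ^ 2
      = |a| * h + 2 * q + h * ∫ z, |z| ∂(cutMeasure κ h) := by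
  have h1 : ∫ z, |z| ∂(cutMeasure κ h)
      = ∫ z, max z 0 ∂(cutMeasure κ h) + ∫ z, max (-z) 0 ∂(cutMeasure κ h) := by
    rw [← integral_add (hκ.integrable_cut hh (by fun_prop)) (hκ.integrable_cut hh (by fun_prop))]
    refine integral_congr_ae (ae_of_all _ fun z => ?_)
    rcases le_total z 0 with hz | hz <;> simp [hz, abs_of_nonneg, abs_of_nonpos]
  have h2 : |a| = max a 0 + max (-a) 0 := by
    rcases le_total a 0 with hz | hz <;> simp [hz, abs_of_nonneg, abs_of_nonpos]
  rw [h1, h2]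
  unfold rateUp rateDown
  field_simp
  ring

lemma IsSmallJump.isFiniteMeasure_approx (hκ : IsSmallJump κ) (a q : ℝ) {h : ℝ} (hh : 0 < h) :
    IsFiniteMeasure (approxMeasure a q κ h) := by
  have := hκ.isFiniteMeasure_cut hh
  have h1 : IsFiniteMeasure (ENNReal.ofReal (rateUp a q κ h) • Measure.dirac h) :=
    Measure.smul_finite _ ENNReal.ofReal_ne_top
  have h2 : IsFiniteMeasure (ENNReal.ofReal (rateDown a q κ h) • Measure.dirac (-h)) :=
    Measure.smul_finite _ ENNReal.ofReal_ne_top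
  unfold approxMeasure
  infer_instance

lemma IsSmallJump.integrable_approx (hκ : IsSmallJump κ) (a q : ℝ) {h : ℝ} (hh : 0 < h) {f : ℝ → ℝ}
    (hf : Continuous f) : Integrable f (approxMeasure a q κ h) := by
  unfold approxMeasure
  have h1 : ∀ x : ℝ, Integrable f (Measure.dirac x) := fun x =>
    integrable_dirac' hf.stronglyMeasurable (by simp)
  exact (((h1 h).smul_measure ENNReal.ofReal_ne_top).add_measure
    ((h1 (-h)).smul_measure ENNReal.ofReal_ne_top)).add_measure (hκ.integrable_cut hh hf)

lemma IsSmallJump.integral_approx (hκ : IsSmallJump κ) (a : ℝ) {q h : ℝ} (hq : 0 ≤ q) (hh : 0 < h)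
    {f : ℝ → ℝ} (hf : Continuous f) :
    ∫ z, f z ∂(approxMeasure a q κ h)
      = rateUp a q κ h * f h + rateDown a q κ h * f (-h) + ∫ z, f z ∂(cutMeasure κ h) := by
  have h1 : ∀ x : ℝ, Integrable f (Measure.dirac x) := fun x =>
    integrable_dirac' hf.stronglyMeasurable (by simp)
  unfold approxMeasure
  rw [integral_add_measure (((h1 h).smul_measure ENNReal.ofReal_ne_top).add_measure
    ((h1 (-h)).smul_measure ENNReal.ofReal_ne_top)) (hκ.integrable_cut hh hf),
    integral_add_measure ((h1 h).smul_measure ENNReal.ofReal_ne_top)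
    ((h1 (-h)).smul_measure ENNReal.ofReal_ne_top), integral_smul_measure, integral_smul_measure,
    integral_dirac, integral_dirac, ENNReal.toReal_ofReal (rateUp_nonneg hq hh),
    ENNReal.toReal_ofReal (rateDown_nonneg hq hh)]
  rfl

lemma ae_approx {r : ℝ} (hr : ∀ᵐ z ∂κ, |z| ≤ r) (a q : ℝ) {h : ℝ} (hh : 0 < h) (hhr : h ≤ r) :
    ∀ᵐ z ∂(approxMeasure a q κ h), |z| ≤ r := by
  have hm : MeasurableSet {z : ℝ | |z| ≤ r} := measurableSet_le (by fun_prop) measurable_const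
  unfold approxMeasure
  rw [ae_add_measure_iff, ae_add_measure_iff]
  refine ⟨⟨Measure.ae_smul_measure ?_ _, Measure.ae_smul_measure ?_ _⟩,
    ae_restrict_of_ae hr⟩
  · rw [ae_dirac_iff hm]; rwa [abs_of_pos hh]
  · rw [ae_dirac_iff hm]; rwa [abs_neg, abs_of_pos hh]

lemma IsSmallJump.approx (hκ : IsSmallJump κ) (a q : ℝ) {h : ℝ} (hh : 0 < h) (hh1 : h ≤ 1) :
    IsSmallJump (approxMeasure a q κ h) :=
  ⟨ae_approx hκ.1 a q hh hh1, hκ.integrable_approx a q hh (by fun_prop)⟩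

lemma IsSmallJump.integral_id_approx (hκ : IsSmallJump κ) (a : ℝ) {q h : ℝ} (hq : 0 ≤ q)
    (hh : 0 < h) : ∫ z, z ∂(approxMeasure a q κ h) = a := by
  rw [hκ.integral_approx a hq hh continuous_id']
  linarith [hκ.rate_sub a q hh]

/-- As the mean of the jump measure is a, compensating its jumps creates the drift term a g'. The
compensated form involves only the mean and the second moment, so it has bounds uniform in h that
the total mass could not give. -/
lemma IsSmallJump.jumpOp_approx (hκ : IsSmallJump κ) (a : ℝ) {q h : ℝ} (hq : 0 ≤ q) (hh : 0 < h)
    (g : ℝ → ℝ) (hg : Continuous g) :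
    jumpOp (approxMeasure a q κ h) g = levyOp a 0 (approxMeasure a q κ h) g := by
  funext y
  have h1 : ∀ z, g (y + z) - g y = (g (y + z) - g y - z * deriv g y) + z * deriv g y :=
    fun z => by ring
  unfold jumpOp levyOp taylorOp
  rw [integral_congr_ae (ae_of_all _ h1),
    integral_add (hκ.integrable_approx a q hh (by fun_prop))
    (hκ.integrable_approx a q hh (by fun_prop)), integral_mul_const,
    hκ.integral_id_approx a hq hh]
  ring

/-- On the retained jumps h|z| ≤ z²; this keeps the second moment of the approximation bounded as h
→ 0. -/
lemma IsSmallJump.mul_integral_abs_cut (hκ : IsSmallJump κ) {h : ℝ} (hh : 0 < h) :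
    h * ∫ z, |z| ∂(cutMeasure κ h) ≤ ∫ z, z ^ 2 ∂κ := by
  rw [← integral_const_mul]
  calc ∫ z, h * |z| ∂(cutMeasure κ h) ≤ ∫ z, z ^ 2 ∂(cutMeasure κ h) := by
        refine integral_mono_ae (hκ.integrable_cut hh (by fun_prop))
          (hκ.integrable_cut hh (by fun_prop)) ?_
        filter_upwards [hκ.ae_cut h] with z hz
        rw [← sq_abs z, sq]
        exact mul_le_mul_of_nonneg_right hz.2.le (abs_nonneg z)
    _ ≤ ∫ z, z ^ 2 ∂κ := setIntegral_le_integral hκ.2 (ae_of_all _ fun z => sq_nonneg z)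

lemma IsSmallJump.integral_sq_approx_le (hκ : IsSmallJump κ) (a : ℝ) {q h : ℝ} (hq : 0 ≤ q)
    (hh : 0 < h) (hh1 : h ≤ 1) :
    ∫ z, z ^ 2 ∂(approxMeasure a q κ h) ≤ |a| + 2 * q + 2 * ∫ z, z ^ 2 ∂κ := by
  rw [hκ.integral_approx a hq hh (by fun_prop)]
  have h1 := hκ.rate_add a q hh
  have h2 := hκ.mul_integral_abs_cut hh
  have h3 : ∫ z, z ^ 2 ∂(cutMeasure κ h) ≤ ∫ z, z ^ 2 ∂κ :=
    setIntegral_le_integral hκ.2 (ae_of_all _ fun z => sq_nonneg z)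
  have h4 : |a| * h ≤ |a| := mul_le_of_le_one_right (abs_nonneg a) hh1
  rw [neg_sq, ← add_mul]
  linarith

/-- A common bound for `levyOp a q κ` and its approximations. -/
def levyBound (a q : ℝ) (κ : Measure ℝ) : ℝ :=
  1 + |a| + |q| + Real.exp 2 * (|a| + 2 * q + 2 * ∫ z, z ^ 2 ∂κ)

lemma one_le_levyBound {a q : ℝ} (hq : 0 ≤ q) : 1 ≤ levyBound a q κ := by
  have := IsSmallJump.sq_nonneg_integral κ
  unfold levyBound
  have : 0 ≤ |a| + |q| + Real.exp 2 * (|a| + 2 * q + 2 * ∫ z, z ^ 2 ∂κ) := by positivity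
  linarith

lemma le_levyBound {a q : ℝ} (hq : 0 ≤ q) :
    |a| + |q| + Real.exp 2 * ∫ z, z ^ 2 ∂κ ≤ levyBound a q κ := by
  have h1 := IsSmallJump.sq_nonneg_integral κ
  have : Real.exp 2 * ∫ z, z ^ 2 ∂κ ≤ Real.exp 2 * (|a| + 2 * q + 2 * ∫ z, z ^ 2 ∂κ) := by
    gcongr; linarith [abs_nonneg a]
  unfold levyBound
  linarith

lemma IsSmallJump.approx_le_levyBound (hκ : IsSmallJump κ) (a : ℝ) {q h : ℝ} (hq : 0 ≤ q)
    (hh : 0 < h) (hh1 : h ≤ 1) :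
    |a| + |(0 : ℝ)| + Real.exp 2 * ∫ z, z ^ 2 ∂(approxMeasure a q κ h) ≤ levyBound a q κ := by
  have h1 : Real.exp 2 * ∫ z, z ^ 2 ∂(approxMeasure a q κ h)
      ≤ Real.exp 2 * (|a| + 2 * q + 2 * ∫ z, z ^ 2 ∂κ) := by
    gcongr; exact hκ.integral_sq_approx_le a hq hh hh1
  unfold levyBound
  rw [abs_zero]
  linarith [abs_nonneg q]

/-- The error of the approximation of `levyOp a q κ`. -/
def approxError (a q : ℝ) (κ : Measure ℝ) (h : ℝ) : ℝ :=
  Real.exp 2 * (h * (|a| * h + 2 * q + h * ∫ z, |z| ∂(cutMeasure κ h)))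
    + (|a| * h + h * ∫ z, |z| ∂(cutMeasure κ h)) / 2
    + Real.exp 2 * ∫ z in {z | h < |z|}ᶜ, z ^ 2 ∂κ

lemma approxError_nonneg {a q h : ℝ} (hq : 0 ≤ q) (hh : 0 < h) : 0 ≤ approxError a q κ h := by
  have h1 : 0 ≤ ∫ z, |z| ∂(cutMeasure κ h) := integral_nonneg fun z => abs_nonneg z
  have h2 : 0 ≤ ∫ z in {z | h < |z|}ᶜ, z ^ 2 ∂κ := integral_nonneg fun z => sq_nonneg z
  unfold approxError; positivity

/-- Dominated convergence with majorant z², both for h|z| on the retained jumps and for z² on the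
dropped ones. -/
lemma IsSmallJump.tendsto_approxError (hκ : IsSmallJump κ) (a q : ℝ) :
    Tendsto (approxError a q κ) (𝓝[>] 0) (𝓝 0) := by
  have hid : Tendsto (fun h : ℝ => h) (𝓝[>] 0) (𝓝 0) := tendsto_nhdsWithin_of_tendsto_nhds tendsto_id
  have hpos : ∀ᶠ h : ℝ in 𝓝[>] 0, 0 < h := eventually_mem_nhdsWithin
  have h1 : Tendsto (fun h => h * ∫ z, |z| ∂(cutMeasure κ h)) (𝓝[>] 0) (𝓝 0) := by
    have := tendsto_integral_filter_of_dominated_convergence (μ := κ) (l := 𝓝[>] (0 : ℝ))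
      (F := fun h z => Set.indicator {z : ℝ | h < |z|} (fun z => h * |z|) z) (f := fun _ => 0)
      (fun z => z ^ 2) (Eventually.of_forall fun h =>
        ((by fun_prop : Measurable fun z : ℝ => h * |z|).indicator
          (measurableSet_cut h)).aestronglyMeasurable)
      (by
        filter_upwards [hpos] with h hh
        refine ae_of_all _ fun z => ?_
        by_cases hz : h < |z|
        · simp only [Set.mem_ofPred_eq, hz, Set.indicator_of_mem, norm_mul, Real.norm_eq_abs,
            abs_abs, abs_of_pos hh]
          rw [← sq_abs z, sq]
          exact mul_le_mul_of_nonneg_right hz.le (abs_nonneg z)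
        · simp [hz, sq_nonneg]) hκ.2
      (ae_of_all _ fun z => by
        refine squeeze_zero_norm (a := fun h => |h| * |z|) (fun h => ?_) ?_
        · refine (norm_indicator_le_norm_self _ _).trans ?_
          simp
        · simpa using hid.abs.mul_const |z|)
    rw [integral_zero] at this
    refine this.congr fun h => ?_
    rw [integral_indicator (measurableSet_cut h), integral_const_mul]
    rfl
  have h2 : Tendsto (fun h => ∫ z in {z | h < |z|}ᶜ, z ^ 2 ∂κ) (𝓝[>] 0) (𝓝 0) := by
    have := tendsto_integral_filter_of_dominated_convergence (μ := κ) (l := 𝓝[>] (0 : ℝ))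
      (F := fun h z => Set.indicator {z : ℝ | h < |z|}ᶜ (fun z => z ^ 2) z) (f := fun _ => 0)
      (fun z => z ^ 2) (Eventually.of_forall fun h =>
        ((by fun_prop : Measurable fun z : ℝ => z ^ 2).indicator
          (measurableSet_cut h).compl).aestronglyMeasurable)
      (Eventually.of_forall fun h => ae_of_all _ fun z =>
        (norm_indicator_le_norm_self _ _).trans (by simp)) hκ.2
      (ae_of_all _ fun z => by
        rcases eq_or_ne z 0 with rfl | hz
        · refine tendsto_const_nhds.congr fun h => ?_
          by_cases h0 : h < 0 <;> simp [h0]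
        · refine tendsto_const_nhds.congr' ?_
          filter_upwards [hid.eventually (gt_mem_nhds (abs_pos.2 hz))] with h hh
          simp [hh])
    rw [integral_zero] at this
    refine this.congr fun h => ?_
    rw [integral_indicator (measurableSet_cut h).compl]
  have h3 : Tendsto (approxError a q κ) (𝓝[>] 0)
      (𝓝 (Real.exp 2 * (0 * (|a| * 0 + 2 * q + 0)) + (|a| * 0 + 0) / 2 + Real.exp 2 * 0)) :=
    (((hid.mul (((hid.const_mul |a|).add_const (2 * q)).add h1)).const_mul (Real.exp 2)).add
      (((hid.const_mul |a|).add h1).div_const 2)).add (h2.const_mul (Real.exp 2))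
  simpa using h3

/-- Three errors: the third-order Taylor remainder at ±h, the excess of half the second moment of
the ±h jumps over q, and the dropped jumps. The retained jumps and the drift match exactly. -/
lemma IsSmallJump.abs_approx_sub_le (hκ : IsSmallJump κ) (a : ℝ) {q h : ℝ} (hq : 0 ≤ q) (hh : 0 < h)
    (hh1 : h ≤ 1) {m : ℕ} {M : ℝ} {g : ℝ → ℝ} (hg : GrowthBound (m + 3) M g) (y : ℝ) :
    |levyOp a 0 (approxMeasure a q κ h) g y - levyOp a q κ g y|
      ≤ approxError a q κ h * M * weight y := by
  have hc := hg.continuous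
  have hM := hg.nonneg
  have hw := weight_pos y
  set R : ℝ → ℝ := fun z => g (y + z) - g y - z * deriv g y with hR
  set U := rateUp a q κ h
  set D := rateDown a q κ h
  set g2 := deriv (deriv g) y
  have hU : 0 ≤ U := rateUp_nonneg hq hh
  have hD : 0 ≤ D := rateDown_nonneg hq hh
  have hUD := hκ.rate_add a q hh
  have hRc : Continuous R := by simp only [hR]; fun_prop
  have e1 : taylorOp (approxMeasure a q κ h) g y
      = U * R h + D * R (-h) + ∫ z, R z ∂(cutMeasure κ h) := hκ.integral_approx a hq hh hRc
  have e2 : taylorOp κ g y = ∫ z, R z ∂(cutMeasure κ h) + ∫ z in {z | h < |z|}ᶜ, R z ∂κ :=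
    (integral_add_compl (measurableSet_cut h) (hκ.integrable_taylor hg y)).symm
  have e3 : levyOp a 0 (approxMeasure a q κ h) g y - levyOp a q κ g y
      = (U * (R h - h ^ 2 / 2 * g2) + D * (R (-h) - h ^ 2 / 2 * g2))
        + ((U + D) * h ^ 2 / 2 - q) * g2 - ∫ z in {z | h < |z|}ᶜ, R z ∂κ := by
    unfold levyOp
    rw [e1, e2]
    ring
  have b1 : |R h - h ^ 2 / 2 * g2| ≤ h ^ 3 * (Real.exp 2 * M * weight y) := by
    have := hg.abs_taylor_three_le (y := y) (z := h) (by rwa [abs_of_pos hh])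
    rwa [abs_of_pos hh] at this
  have b2 : |R (-h) - h ^ 2 / 2 * g2| ≤ h ^ 3 * (Real.exp 2 * M * weight y) := by
    have := hg.abs_taylor_three_le (y := y) (z := -h) (by rwa [abs_neg, abs_of_pos hh])
    rwa [abs_neg, abs_of_pos hh, neg_sq] at this
  have b3 : |g2| ≤ M * weight y := hg.deriv.deriv.bound y
  have b4 : |∫ z in {z | h < |z|}ᶜ, R z ∂κ|
      ≤ (∫ z in {z | h < |z|}ᶜ, z ^ 2 ∂κ) * (Real.exp 2 * M * weight y) := by
    rw [← Real.norm_eq_abs, ← integral_mul_const]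
    refine norm_integral_le_of_norm_le (hκ.2.integrableOn.mul_const _) ?_
    filter_upwards [ae_restrict_of_ae hκ.1] with z hz using hg.abs_taylor_two_le hz
  have b5 : 0 ≤ (U + D) * h ^ 2 / 2 - q := by
    have h1 : 0 ≤ ∫ z, |z| ∂(cutMeasure κ h) := integral_nonneg fun z => abs_nonneg z
    have h2 : 0 ≤ h * ∫ z, |z| ∂(cutMeasure κ h) := by positivity
    have h3 : 0 ≤ |a| * h := by positivity
    linarith
  rw [e3]
  calc _ ≤ (U * (h ^ 3 * (Real.exp 2 * M * weight y)) + D * (h ^ 3 * (Real.exp 2 * M * weight y)))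
        + ((U + D) * h ^ 2 / 2 - q) * (M * weight y)
        + (∫ z in {z | h < |z|}ᶜ, z ^ 2 ∂κ) * (Real.exp 2 * M * weight y) := by
        refine (abs_sub _ _).trans (add_le_add ((abs_add_le _ _).trans (add_le_add
          ((abs_add_le _ _).trans (add_le_add ?_ ?_)) ?_)) b4)
        · rw [abs_mul, abs_of_nonneg hU]; gcongr
        · rw [abs_mul, abs_of_nonneg hD]; gcongr
        · rw [abs_mul, abs_of_nonneg b5]; gcongr
    _ = _ := by
        unfold approxError
        have : U * (h ^ 3 * (Real.exp 2 * M * weight y)) + D * (h ^ 3 * (Real.exp 2 * M * weight y))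
          = ((U + D) * h ^ 2) * h * (Real.exp 2 * M * weight y) := by ring
        rw [this, hUD]
        ring

lemma IsSmallJump.growthBound_approx_sub (hκ : IsSmallJump κ) (a : ℝ) {q h : ℝ} (hq : 0 ≤ q)
    (hh : 0 < h) (hh1 : h ≤ 1) {m : ℕ} {M : ℝ} {g : ℝ → ℝ} (hg : GrowthBound (m + 3) M g) :
    GrowthBound m (approxError a q κ h * M)
      (fun y => levyOp a 0 (approxMeasure a q κ h) g y - levyOp a q κ g y) := by
  have hκ' := hκ.approx a q hh hh1
  induction m generalizing g with
  | zero =>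
    exact ⟨(hκ'.growthBound_levyOp a 0 hg).continuous.sub (hκ.growthBound_levyOp a q hg).continuous,
      hκ.abs_approx_sub_le (m := 0) a hq hh hh1 hg⟩
  | succ m ih =>
    exact GrowthBound.succ_of_hasDerivAt (hκ.abs_approx_sub_le (m := m + 1) a hq hh hh1 hg)
      (fun y => (hκ'.hasDerivAt_levyOp (m := m + 1) a 0 hg y).sub
        (hκ.hasDerivAt_levyOp (m := m + 1) a q hg y)) (ih hg.deriv)

lemma IsSmallJump.growthBound_iterate_approx_sub (hκ : IsSmallJump κ) (a : ℝ) {q h : ℝ} (hq : 0 ≤ q)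
    (hh : 0 < h) (hh1 : h ≤ 1) (j : ℕ) {m : ℕ} {M : ℝ} {g : ℝ → ℝ}
    (hg : GrowthBound (m + 3 * j) M g) :
    GrowthBound m (j * levyBound a q κ ^ j * approxError a q κ h * M)
      (fun y => (levyOp a 0 (approxMeasure a q κ h))^[j] g y - (levyOp a q κ)^[j] g y) := by
  have hκ' := hκ.approx a q hh hh1
  have hM := hg.nonneg
  have hη := approxError_nonneg (κ := κ) (a := a) hq hh
  have hK := one_le_levyBound (κ := κ) (a := a) hq
  induction j generalizing m with
  | zero =>
    have : GrowthBound m (0 * M) (fun y => 0 * g y) := by simpa using hg.const_mul 0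
    simpa using this
  | succ j ih =>
    have i1 := ih (m := m + 3) (hg.of_le (by omega))
    have i2 := hκ.growthBound_iterate_levyOp (le_levyBound (a := a) hq) j (m := m + 3)
      (hg.of_le (by omega))
    have i3 := hκ'.growthBound_iterate_levyOp (hκ.approx_le_levyBound a hq hh hh1) j (m := m + 3)
      (hg.of_le (by omega))
    have s1 := hκ'.growthBound_levyOp a 0 i1
    have s2 := hκ.growthBound_approx_sub a hq hh hh1 i2
    have s3 := (s1.mono (mul_le_mul_of_nonneg_right (hκ.approx_le_levyBound a hq hh hh1)
      i1.nonneg)).add s2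
    -- Telescoping A^{j+1} - B^{j+1} = A(Aʲ - Bʲ) + (A - B)Bʲ, one error per step, hence the factor
    -- j in the bound.
    have hf : (fun y => (levyOp a 0 (approxMeasure a q κ h))^[j + 1] g y
        - (levyOp a q κ)^[j + 1] g y) = fun y =>
        levyOp a 0 (approxMeasure a q κ h) (fun y => (levyOp a 0 (approxMeasure a q κ h))^[j] g y
        - (levyOp a q κ)^[j] g y) y + (levyOp a 0 (approxMeasure a q κ h) ((levyOp a q κ)^[j] g) y
          - levyOp a q κ ((levyOp a q κ)^[j] g) y) := by
      funext y
      rw [Function.iterate_succ_apply', Function.iterate_succ_apply',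
        hκ'.levyOp_sub a 0 (m := m + 1) (m' := m + 1) i3 i2]
      ring
    rw [hf]
    refine s3.mono ?_
    set K := levyBound a q κ
    have : K ^ j ≤ K ^ (j + 1) := pow_le_pow_right₀ hK (by omega)
    have h2 : approxError a q κ h * (K ^ j * M) ≤ approxError a q κ h * (K ^ (j + 1) * M) := by
      gcongr
    push_cast
    rw [pow_succ] at h2 ⊢
    linarith

lemma IsSmallJump.tendsto_iterate_approx (hκ : IsSmallJump κ) (a : ℝ) {q : ℝ} (hq : 0 ≤ q)
    (j : ℕ) {M : ℝ} {g : ℝ → ℝ} (hg : GrowthBound (3 * j) M g) (y : ℝ) :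
    Tendsto (fun h => (levyOp a 0 (approxMeasure a q κ h))^[j] g y) (𝓝[>] 0)
      (𝓝 ((levyOp a q κ)^[j] g y)) := by
  rw [tendsto_iff_norm_sub_tendsto_zero]
  have hb : ∀ᶠ h : ℝ in 𝓝[>] 0, ‖(levyOp a 0 (approxMeasure a q κ h))^[j] g y
      - (levyOp a q κ)^[j] g y‖
      ≤ j * levyBound a q κ ^ j * approxError a q κ h * M * weight y := by
    filter_upwards [Ioc_mem_nhdsGT (zero_lt_one' ℝ)] with h hh
    exact (hκ.growthBound_iterate_approx_sub a hq hh.1 hh.2 j (m := 0) (by simpa using hg)).bound y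
  refine squeeze_zero' (Eventually.of_forall fun h => norm_nonneg _) hb ?_
  have := (((hκ.tendsto_approxError a q).const_mul (j * levyBound a q κ ^ j)).mul_const M).mul_const
    (weight y)
  simpa using this

end Approx

/-! ### Uniform moments and convergence of the approximating laws. -/

lemma growthBound_exp_two (m : ℕ) (A : ℝ) :
    GrowthBound m (|A| * 2 ^ m) (fun x => A * Real.exp (2 * x)) := by
  have hb : ∀ (m : ℕ) (A y : ℝ), |A * Real.exp (2 * y)| ≤ |A| * 2 ^ m * weight y := by
    intro m A y
    rw [abs_mul, abs_of_pos (Real.exp_pos _), mul_assoc]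
    refine mul_le_mul_of_nonneg_left ?_ (abs_nonneg A)
    have h1 : (1 : ℝ) ≤ 2 ^ m := one_le_pow₀ (by norm_num)
    have h2 : Real.exp (2 * y) ≤ weight y := by unfold weight; linarith
    exact h2.trans (le_mul_of_one_le_left (weight_pos y).le h1)
  induction m generalizing A with
  | zero => exact ⟨by fun_prop, hb 0 A⟩
  | succ m ih =>
    refine GrowthBound.succ_of_hasDerivAt (hb (m + 1) A)
      (g' := fun x => (2 * A) * Real.exp (2 * x)) (fun y => ?_) ?_
    · have := (((hasDerivAt_id y).const_mul 2).exp).const_mul A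
      refine this.congr_deriv ?_
      simp only [id]; ring
    · refine (ih (2 * A)).mono (le_of_eq ?_)
      rw [abs_mul, pow_succ]; simp; ring

/-- Real and imaginary parts of e^{iux} serve as test functions, so the convergence of generators
yields that of characteristic functions. The two-parameter family is closed under differentiation.
-/
lemma growthBound_trig (m : ℕ) (u A B : ℝ) :
    GrowthBound m ((|A| + |B|) * (1 + |u|) ^ m)
      (fun x => A * Real.cos (u * x) + B * Real.sin (u * x)) := by
  have hb : ∀ (m : ℕ) (A B y : ℝ), |A * Real.cos (u * y) + B * Real.sin (u * y)|
      ≤ (|A| + |B|) * (1 + |u|) ^ m * weight y := by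
    intro m A B y
    have h1 : |A * Real.cos (u * y) + B * Real.sin (u * y)| ≤ |A| + |B| := by
      refine (abs_add_le _ _).trans (add_le_add ?_ ?_)
      · rw [abs_mul]; exact mul_le_of_le_one_right (abs_nonneg _) (Real.abs_cos_le_one _)
      · rw [abs_mul]; exact mul_le_of_le_one_right (abs_nonneg _) (Real.abs_sin_le_one _)
    refine h1.trans ?_
    rw [mul_assoc]
    refine le_mul_of_one_le_right (by positivity) ?_
    exact one_le_mul_of_one_le_of_one_le (one_le_pow₀ (by linarith [abs_nonneg u])) (one_le_weight y)
  induction m generalizing A B with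
  | zero => exact ⟨by fun_prop, hb 0 A B⟩
  | succ m ih =>
    refine GrowthBound.succ_of_hasDerivAt (hb (m + 1) A B)
      (g' := fun x => (u * B) * Real.cos (u * x) + (-(u * A)) * Real.sin (u * x)) (fun y => ?_) ?_
    · have h1 := (((hasDerivAt_id y).const_mul u).cos).const_mul A
      have h2 := (((hasDerivAt_id y).const_mul u).sin).const_mul B
      refine (h1.add h2).congr_deriv ?_
      simp only [id]; ring
    · refine (ih (u * B) (-(u * A))).mono ?_
      rw [abs_neg, abs_mul, abs_mul, ← mul_add, pow_succ]
      have : 0 ≤ (|A| + |B|) * (1 + |u|) ^ m := by positivity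
      nlinarith

lemma deriv_trig (u A B : ℝ) : deriv (fun x => A * Real.cos (u * x) + B * Real.sin (u * x))
    = fun x => (u * B) * Real.cos (u * x) + (-(u * A)) * Real.sin (u * x) := by
  funext y
  have h1 := (((hasDerivAt_id y).const_mul u).cos).const_mul A
  have h2 := (((hasDerivAt_id y).const_mul u).sin).const_mul B
  refine ((h1.add h2).congr_deriv ?_).deriv
  simp only [id]; ring

section Approx

variable {κ : Measure ℝ}

lemma IsSmallJump.iterate_jumpOp_approx (hκ : IsSmallJump κ) (a : ℝ) {q h : ℝ} (hq : 0 ≤ q)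
    (hh : 0 < h) (hh1 : h ≤ 1) (j : ℕ) {M : ℝ} {g : ℝ → ℝ} (hg : GrowthBound (3 * j) M g) :
    (jumpOp (approxMeasure a q κ h))^[j] g = (levyOp a 0 (approxMeasure a q κ h))^[j] g := by
  induction j with
  | zero => rfl
  | succ j ih =>
    rw [Function.iterate_succ_apply', Function.iterate_succ_apply', ih (hg.of_le (by omega)),
      hκ.jumpOp_approx a hq hh]
    exact ((hκ.approx a q hh hh1).growthBound_iterate_levyOp
      (hκ.approx_le_levyBound a hq hh hh1) j (m := 0) (hg.of_le (by omega))).continuous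

/-- Bound for `∫ weight` under the approximating laws up to time one. -/
def momentBound (a q : ℝ) (κ : Measure ℝ) : ℝ := 1 + Real.exp (16 * levyBound a q κ)

lemma one_le_momentBound (a q : ℝ) (κ : Measure ℝ) : 1 ≤ momentBound a q κ := by
  unfold momentBound; linarith [Real.exp_pos (16 * levyBound a q κ)]

lemma IsSmallJump.integrable_weight_compoundPoisson (hκ : IsSmallJump κ) (a q : ℝ) {h t : ℝ}
    (hh : 0 < h) (ht : 0 ≤ t) :
    Integrable weight (compoundPoisson (approxMeasure a q κ h) t) := by
  have := hκ.isFiniteMeasure_approx a q hh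
  have := isProbabilityMeasure_compoundPoisson (approxMeasure a q κ h) ht
  exact integrable_weight (integrable_exp_compoundPoisson _ ht 2
    (hκ.integrable_approx a q hh (by fun_prop)))

/-- The exponent is t times the generator applied to e^{2x} at 0, bounded independently of h. The
constant is 16 = 2³ · 2: three derivatives of e^{2x}, times `weight 0`. -/
lemma IsSmallJump.integral_exp_compoundPoisson_le (hκ : IsSmallJump κ) (a : ℝ) {q h t : ℝ}
    (hq : 0 ≤ q) (hh : 0 < h) (hh1 : h ≤ 1) (ht : 0 ≤ t) :
    ∫ x, Real.exp (2 * x) ∂(compoundPoisson (approxMeasure a q κ h) t)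
      ≤ Real.exp (t * (16 * levyBound a q κ)) := by
  have := hκ.isFiniteMeasure_approx a q hh
  rw [integral_exp_compoundPoisson _ ht 2 (hκ.integrable_approx a q hh (by fun_prop))]
  refine Real.exp_le_exp.2 ?_
  have hg : GrowthBound 3 8 (fun x => Real.exp (2 * x)) := by
    have := growthBound_exp_two 3 1
    norm_num at this
    exact this
  have h1 := ((hκ.approx a q hh hh1).growthBound_levyOp a 0 (m := 0) hg).bound 0
  rw [← hκ.jumpOp_approx a hq hh _ hg.continuous] at h1
  have h2 : ∫ x, (Real.exp (2 * x) - 1) ∂(approxMeasure a q κ h)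
      = jumpOp (approxMeasure a q κ h) (fun x => Real.exp (2 * x)) 0 := by
    simp [jumpOp]
  have h3 := hκ.approx_le_levyBound a hq hh hh1
  have h4 : weight 0 = 2 := by unfold weight; norm_num
  rw [h4] at h1
  rw [h2]
  have h5 : |jumpOp (approxMeasure a q κ h) (fun x => Real.exp (2 * x)) 0|
      ≤ 16 * levyBound a q κ := by linarith
  exact mul_le_mul_of_nonneg_left ((le_abs_self _).trans h5) ht

lemma IsSmallJump.integral_weight_compoundPoisson_le (hκ : IsSmallJump κ) (a : ℝ) {q h t : ℝ}
    (hq : 0 ≤ q) (hh : 0 < h) (hh1 : h ≤ 1) (ht : 0 ≤ t) (ht1 : t ≤ 1) :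
    ∫ x, weight x ∂(compoundPoisson (approxMeasure a q κ h) t) ≤ momentBound a q κ := by
  have := hκ.isFiniteMeasure_approx a q hh
  have := isProbabilityMeasure_compoundPoisson (approxMeasure a q κ h) ht
  unfold weight momentBound
  rw [integral_add (integrable_const _) (integrable_exp_compoundPoisson _ ht 2
    (hκ.integrable_approx a q hh (by fun_prop)))]
  have hK := one_le_levyBound (κ := κ) (a := a) hq
  have h1 : Real.exp (t * (16 * levyBound a q κ)) ≤ Real.exp (16 * levyBound a q κ) :=
    Real.exp_le_exp.2 (mul_le_of_le_one_left (by linarith) ht1)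
  simpa using (hκ.integral_exp_compoundPoisson_le a hq hh hh1 ht).trans h1

lemma IsSmallJump.abs_integral_compoundPoisson_le (hκ : IsSmallJump κ) (a : ℝ) {q h t : ℝ}
    (hq : 0 ≤ q) (hh : 0 < h) (hh1 : h ≤ 1) (ht : 0 ≤ t) (ht1 : t ≤ 1) {m : ℕ} {M : ℝ} {g : ℝ → ℝ}
    (hg : GrowthBound m M g) :
    |∫ x, g x ∂(compoundPoisson (approxMeasure a q κ h) t)| ≤ M * momentBound a q κ := by
  rw [← Real.norm_eq_abs]
  refine (norm_integral_le_of_norm_le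
    ((hκ.integrable_weight_compoundPoisson a q hh ht).const_mul M)
    (ae_of_all _ hg.bound)).trans ?_
  rw [integral_const_mul]
  exact mul_le_mul_of_nonneg_left (hκ.integral_weight_compoundPoisson_le a hq hh hh1 ht ht1)
    hg.nonneg

/-- Uniform Taylor expansion of the approximating semigroups. -/
lemma IsSmallJump.abs_integral_approx_sub_le (hκ : IsSmallJump κ) (a : ℝ) {q h t : ℝ}
    (hq : 0 ≤ q) (hh : 0 < h) (hh1 : h ≤ 1) (ht : 0 ≤ t) (ht1 : t ≤ 1) (N : ℕ) {M : ℝ} {g : ℝ → ℝ}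
    (hg : GrowthBound (3 * N) M g) :
    |∫ x, g x ∂(compoundPoisson (approxMeasure a q κ h) t)
      - ∑ j ∈ Finset.range N,
        t ^ j / j.factorial * (jumpOp (approxMeasure a q κ h))^[j] g 0|
      ≤ levyBound a q κ ^ N * M * momentBound a q κ * t ^ N := by
  have := hκ.isFiniteMeasure_approx a q hh
  have key : ∀ j ≤ N, GrowthBound 0 (levyBound a q κ ^ j * M)
      ((jumpOp (approxMeasure a q κ h))^[j] g) := by
    intro j hj
    rw [hκ.iterate_jumpOp_approx a hq hh hh1 j (hg.of_le (by omega))]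
    exact (hκ.approx a q hh hh1).growthBound_iterate_levyOp
      (hκ.approx_le_levyBound a hq hh hh1) j (m := 0) (hg.of_le (by omega))
  refine abs_integral_compoundPoisson_sub_le _ (hκ.integrable_approx a q hh (by fun_prop)) N g
    (fun j hj => ⟨_, key j hj⟩) (fun r hr hr1 => ?_) ht ht1
  exact hκ.abs_integral_compoundPoisson_le a hq hh hh1 hr hr1 (key N le_rfl)

lemma jumpOp_eq_zero_of_lt {α : Measure ℝ} {ε r : ℝ} (hα : ∀ᵐ z ∂α, |z| ≤ ε) (hε : 0 ≤ ε)
    {g : ℝ → ℝ} (hg : ∀ y < r, g y = 0) : ∀ y < r - ε, jumpOp α g y = 0 := by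
  intro y hy
  refine integral_eq_zero_of_ae ?_
  filter_upwards [hα] with z hz
  rw [hg (y + z) (by linarith [(abs_le.1 hz).2]), hg y (by linarith)]
  simp

/-- Jumps of size at most ε move the support to the left by at most ε per application. This kills
the low-order terms of the expansion without big jumps. -/
lemma iterate_jumpOp_eq_zero_of_lt {α : Measure ℝ} {ε r : ℝ} (hα : ∀ᵐ z ∂α, |z| ≤ ε) (hε : 0 ≤ ε)
    {g : ℝ → ℝ} (hg : ∀ y < r, g y = 0) (j : ℕ) : ∀ y < r - j * ε, (jumpOp α)^[j] g y = 0 := by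
  induction j with
  | zero => simpa using hg
  | succ j ih =>
    rw [Function.iterate_succ_apply']
    intro y hy
    refine jumpOp_eq_zero_of_lt hα hε ih y ?_
    push_cast at hy
    linarith

lemma IsSmallJump.integrable_cexp (hκ : IsSmallJump κ) (u : ℝ) :
    Integrable (fun z : ℝ => Complex.exp (u * z * Complex.I) - 1 - u * z * Complex.I) κ := by
  have h1 := (hκ.integrable_taylor (m := 1) (growthBound_trig 3 u 1 0) 0)
  have h2 := (hκ.integrable_taylor (m := 1) (growthBound_trig 3 u 0 1) 0)
  simp only [deriv_trig] at h1 h2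
  have h3 := h1.ofReal (𝕜 := ℂ).add (h2.ofReal (𝕜 := ℂ).mul_const Complex.I)
  refine h3.congr (ae_of_all _ fun z => ?_)
  simp only [Pi.add_apply]
  have e : Complex.exp (u * z * Complex.I)
      = Complex.cos (u * z) + Complex.sin (u * z) * Complex.I := Complex.exp_mul_I _
  rw [e]
  simp
  ring

/-- The generator applied to e^{iux} at 0 is its Lévy–Khintchine symbol, read off from the cosine
and sine parts. -/
lemma IsSmallJump.levyOp_trig (hκ : IsSmallJump κ) (a q u : ℝ) :
    (levyOp a q κ (fun x => 1 * Real.cos (u * x) + 0 * Real.sin (u * x)) 0 : ℂ)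
      + levyOp a q κ (fun x => 0 * Real.cos (u * x) + 1 * Real.sin (u * x)) 0 * Complex.I
    = a * u * Complex.I - q * u ^ 2
      + ∫ z : ℝ, (Complex.exp (u * z * Complex.I) - 1 - u * z * Complex.I) ∂κ := by
  have h1 := (hκ.integrable_taylor (m := 1) (growthBound_trig 3 u 1 0) 0)
  have h2 := (hκ.integrable_taylor (m := 1) (growthBound_trig 3 u 0 1) 0)
  have hI : ∫ z : ℝ, (Complex.exp (u * z * Complex.I) - 1 - u * z * Complex.I) ∂κ
      = (taylorOp κ (fun x => 1 * Real.cos (u * x) + 0 * Real.sin (u * x)) 0 : ℂ)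
      + taylorOp κ (fun x => 0 * Real.cos (u * x) + 1 * Real.sin (u * x)) 0 * Complex.I := by
    unfold taylorOp
    rw [← integral_complex_ofReal, ← integral_complex_ofReal, ← integral_mul_const,
      ← integral_add h1.ofReal (h2.ofReal.mul_const _)]
    refine integral_congr_ae (ae_of_all _ fun z => ?_)
    have e : Complex.exp (u * z * Complex.I)
      = Complex.cos (u * z) + Complex.sin (u * z) * Complex.I := Complex.exp_mul_I _
    simp only [deriv_trig, e]
    simp
    ring
  rw [hI]
  unfold levyOp
  simp only [deriv_trig]
  simp
  ring

lemma IsSmallJump.charFun_approx_sub (hκ : IsSmallJump κ) (a q : ℝ) {h : ℝ} (hh : 0 < h) (u : ℝ) :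
    charFun (approxMeasure a q κ h) u - ((approxMeasure a q κ h).real Set.univ : ℂ)
      = (jumpOp (approxMeasure a q κ h)
          (fun x => 1 * Real.cos (u * x) + 0 * Real.sin (u * x)) 0 : ℂ)
      + jumpOp (approxMeasure a q κ h)
          (fun x => 0 * Real.cos (u * x) + 1 * Real.sin (u * x)) 0 * Complex.I := by
  have := hκ.isFiniteMeasure_approx a q hh
  have h1 : Integrable (fun w => Real.cos (u * w) - 1) (approxMeasure a q κ h) :=
    hκ.integrable_approx a q hh (by fun_prop)
  have h2 : Integrable (fun w => Real.sin (u * w)) (approxMeasure a q κ h) :=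
    hκ.integrable_approx a q hh (by fun_prop)
  have h3 : Integrable (fun x : ℝ => Complex.exp (u * x * Complex.I)) (approxMeasure a q κ h) := by
    refine Integrable.of_bound (C := 1) (by fun_prop) (ae_of_all _ fun x => ?_)
    rw [← Complex.ofReal_mul, Complex.norm_exp_ofReal_mul_I]
  have h4 : ((approxMeasure a q κ h).real Set.univ : ℂ) = ∫ _, (1 : ℂ) ∂(approxMeasure a q κ h) := by
    simp
  rw [charFun_apply_real, h4, ← integral_sub h3 (integrable_const _)]
  unfold jumpOp
  simp only [zero_add, one_mul, zero_mul, add_zero, mul_zero, Real.cos_zero, Real.sin_zero,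
    sub_zero]
  rw [← integral_complex_ofReal, ← integral_complex_ofReal, ← integral_mul_const,
      ← integral_add h1.ofReal (h2.ofReal.mul_const _)]
  refine integral_congr_ae (ae_of_all _ fun z => ?_)
  have e : Complex.exp (u * z * Complex.I)
    = Complex.cos (u * z) + Complex.sin (u * z) * Complex.I := Complex.exp_mul_I _
  simp only [e]
  simp
  ring

/-- The approximating laws converge, in the sense of characteristic functions. -/
lemma IsSmallJump.tendsto_charFun_approx (hκ : IsSmallJump κ) (a : ℝ) {q t : ℝ} (hq : 0 ≤ q)
    (ht : 0 ≤ t) (u : ℝ) :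
    Tendsto (fun h => charFun (compoundPoisson (approxMeasure a q κ h) t) u) (𝓝[>] 0)
      (𝓝 (Complex.exp (t * (a * u * Complex.I - q * u ^ 2
        + ∫ z : ℝ, (Complex.exp (u * z * Complex.I) - 1 - u * z * Complex.I) ∂κ)))) := by
  have g1 := growthBound_trig (3 * 1) u 1 0
  have g2 := growthBound_trig (3 * 1) u 0 1
  have t1 := hκ.tendsto_iterate_approx a hq 1 g1 0
  have t2 := hκ.tendsto_iterate_approx a hq 1 g2 0
  have t3 := ((Complex.continuous_ofReal.tendsto _).comp t1).add
    (((Complex.continuous_ofReal.tendsto _).comp t2).mul_const Complex.I)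
  simp only [Function.iterate_one] at t3
  rw [hκ.levyOp_trig] at t3
  have t4 := (Complex.continuous_exp.tendsto _).comp (t3.const_mul (t : ℂ))
  refine t4.congr' ?_
  filter_upwards [Ioc_mem_nhdsGT (zero_lt_one' ℝ)] with h hh
  have := hκ.isFiniteMeasure_approx a q hh.1
  rw [charFun_compoundPoisson _ ht, hκ.charFun_approx_sub a q hh.1]
  simp only [Function.comp_apply]
  rw [hκ.jumpOp_approx a hq hh.1 _ g1.continuous, hκ.jumpOp_approx a hq hh.1 _ g2.continuous]

end Approx

/-! ### Smooth densities, their convolution powers, and smoothed call prices. -/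

/-- `f` is `m` times differentiable and its derivatives up to order `m` are continuous and bounded
by `C`. -/
def BddDeriv : ℕ → ℝ → (ℝ → ℝ) → Prop
  | 0, C, f => Continuous f ∧ ∀ x, |f x| ≤ C
  | m + 1, C, f => (∀ x, |f x| ≤ C) ∧ Differentiable ℝ f ∧ BddDeriv m C (deriv f)

lemma BddDeriv.bound {m : ℕ} {C : ℝ} {f : ℝ → ℝ} (h : BddDeriv m C f) (x : ℝ) : |f x| ≤ C := by
  cases m with
  | zero => exact h.2 x
  | succ m => exact h.1 x

lemma BddDeriv.continuous {m : ℕ} {C : ℝ} {f : ℝ → ℝ} (h : BddDeriv m C f) : Continuous f := by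
  cases m with
  | zero => exact h.1
  | succ m => exact h.2.1.continuous

lemma BddDeriv.nonneg {m : ℕ} {C : ℝ} {f : ℝ → ℝ} (h : BddDeriv m C f) : 0 ≤ C :=
  (abs_nonneg _).trans (h.bound 0)

lemma BddDeriv.hasDerivAt {m : ℕ} {C : ℝ} {f : ℝ → ℝ} (h : BddDeriv (m + 1) C f) (x : ℝ) :
    HasDerivAt f (deriv f x) x := (h.2.1 x).hasDerivAt

lemma BddDeriv.succ_of_hasDerivAt {m : ℕ} {C : ℝ} {f f' : ℝ → ℝ}
    (hb : ∀ y, |f y| ≤ C) (hd : ∀ y, HasDerivAt f (f' y) y) (h : BddDeriv m C f') :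
    BddDeriv (m + 1) C f :=
  ⟨hb, fun y => (hd y).differentiableAt, by
    rwa [show deriv f = f' from funext fun y => (hd y).deriv]⟩

lemma BddDeriv.of_iteratedDeriv {m : ℕ} {C : ℝ} {f : ℝ → ℝ} (hf : ContDiff ℝ ∞ f)
    (hb : ∀ k ≤ m, ∀ x, |iteratedDeriv k f x| ≤ C) : BddDeriv m C f := by
  induction m generalizing f with
  | zero => exact ⟨hf.continuous, by simpa using hb 0 le_rfl⟩
  | succ m ih =>
    refine ⟨by simpa using hb 0 (by omega), hf.differentiable (by simp),
      ih (contDiff_infty_iff_deriv.1 hf).2 fun k hk x => ?_⟩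
    rw [← iteratedDeriv_succ']
    exact hb (k + 1) (by omega) x

lemma BddDeriv.growthBound {m : ℕ} {C : ℝ} {f : ℝ → ℝ} (h : BddDeriv m C f) :
    GrowthBound m C f := by
  have hb : ∀ y, |f y| ≤ C * weight y := fun y =>
    (h.bound y).trans (le_mul_of_one_le_right h.nonneg (one_le_weight y))
  induction m generalizing f with
  | zero => exact ⟨h.1, hb⟩
  | succ m ih =>
    exact ⟨hb, h.2.1, ih h.2.2 fun y =>
      (h.2.2.bound y).trans (le_mul_of_one_le_right h.2.2.nonneg (one_le_weight y))⟩

/-- Both signs are carried together because each differentiation exchanges them. -/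
lemma BddDeriv.comp_neg {m : ℕ} {C : ℝ} {f : ℝ → ℝ} (h : BddDeriv m C f) :
    BddDeriv m C (fun x => f (-x)) ∧ BddDeriv m C (fun x => -f (-x)) := by
  induction m generalizing f with
  | zero =>
    have hc := h.1
    exact ⟨⟨by fun_prop, fun x => h.2 _⟩, ⟨by fun_prop, fun x => by simpa using h.2 (-x)⟩⟩
  | succ m ih =>
    have h1 := ih h.2.2
    have h2 : ∀ y, HasDerivAt (fun x => f (-x)) (-deriv f (-y)) y := fun y =>
      ((h.hasDerivAt (-y)).comp y (hasDerivAt_neg y)).congr_deriv (by simp)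
    refine ⟨succ_of_hasDerivAt (fun y => h.1 _) h2 h1.2,
      succ_of_hasDerivAt (fun y => by simpa using h.1 (-y)) (fun y => (h2 y).neg) ?_⟩
    simpa using h1.1

lemma BddDeriv.integrable_conv {m : ℕ} {C : ℝ} {f g : ℝ → ℝ} (hf : BddDeriv m C f)
    (hg : Integrable g) (x : ℝ) : Integrable (fun u => f (x - u) * g u) := by
  have hc := hf.continuous
  exact hg.bdd_mul (c := C) (by fun_prop) (ae_of_all _ fun u => hf.bound _)

lemma BddDeriv.abs_conv_le {m : ℕ} {C : ℝ} {f g : ℝ → ℝ} (hf : BddDeriv m C f)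
    (hg : Integrable g) (x : ℝ) : |∫ u, f (x - u) * g u| ≤ C * ∫ u, |g u| := by
  rw [← Real.norm_eq_abs, ← integral_const_mul]
  refine norm_integral_le_of_norm_le (hg.abs.const_mul C) (ae_of_all _ fun u => ?_)
  rw [norm_mul]
  exact mul_le_mul_of_nonneg_right (hf.bound _) (abs_nonneg _)

/-- All derivatives fall on f, so g need only be integrable. -/
lemma BddDeriv.conv {m : ℕ} {C : ℝ} {f g : ℝ → ℝ} (hf : BddDeriv m C f) (hg : Integrable g) :
    BddDeriv m (C * ∫ u, |g u|) (fun x => ∫ u, f (x - u) * g u) := by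
  induction m generalizing f with
  | zero =>
    refine ⟨?_, hf.abs_conv_le hg⟩
    have hc := hf.1
    refine continuous_of_dominated (bound := fun u => C * |g u|)
      (fun x => (hf.integrable_conv hg x).aestronglyMeasurable) (fun x => ae_of_all _ fun u => ?_)
      (hg.abs.const_mul C) (ae_of_all _ fun u => by fun_prop)
    rw [norm_mul]
    exact mul_le_mul_of_nonneg_right (hf.bound _) (abs_nonneg _)
  | succ m ih =>
    refine succ_of_hasDerivAt (hf.abs_conv_le hg) (fun x => ?_) (ih hf.2.2)
    refine (hasDerivAt_integral_of_dominated_loc_of_deriv_le (bound := fun u => C * |g u|)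
      (F := fun x u => f (x - u) * g u) (F' := fun x u => deriv f (x - u) * g u)
      (s := Set.univ) univ_mem
      (Eventually.of_forall fun x => (hf.integrable_conv hg x).aestronglyMeasurable)
      (hf.integrable_conv hg x) (BddDeriv.integrable_conv hf.2.2 hg x).aestronglyMeasurable
      (ae_of_all _ fun u y _ => ?_) (hg.abs.const_mul C) (ae_of_all _ fun u y _ => ?_)).2
    · rw [norm_mul]
      exact mul_le_mul_of_nonneg_right (BddDeriv.bound hf.2.2 _) (abs_nonneg _)
    · exact ((hf.hasDerivAt (y - u)).comp_sub_const y u).mul_const (g u)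

/-- The measure with density `f`. -/
def densMeasure (f : ℝ → ℝ) : Measure ℝ := volume.withDensity fun x => ENNReal.ofReal (f x)

lemma integrable_densMeasure_iff {f : ℝ → ℝ} (hf : Continuous f) (h0 : ∀ x, 0 ≤ f x) {g : ℝ → ℝ} :
    Integrable g (densMeasure f) ↔ Integrable fun x => g x * f x := by
  unfold densMeasure
  rw [integrable_withDensity_iff (by fun_prop) (ae_of_all _ fun x => ENNReal.ofReal_lt_top)]
  simp_rw [ENNReal.toReal_ofReal (h0 _)]

lemma integral_densMeasure {f : ℝ → ℝ} (hf : Continuous f) (h0 : ∀ x, 0 ≤ f x) (g : ℝ → ℝ) :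
    ∫ x, g x ∂(densMeasure f) = ∫ x, g x * f x := by
  unfold densMeasure
  rw [integral_withDensity_eq_integral_toReal_smul (by fun_prop)
    (ae_of_all _ fun x => ENNReal.ofReal_lt_top)]
  simp_rw [ENNReal.toReal_ofReal (h0 _), smul_eq_mul, mul_comm]

lemma densMeasure_conv {m : ℕ} {C : ℝ} {f g : ℝ → ℝ} (hf : BddDeriv m C f) (hf0 : ∀ x, 0 ≤ f x)
    (hg : Continuous g) (hg0 : ∀ x, 0 ≤ g x) (hgi : Integrable g) :
    Measure.conv (densMeasure f) (densMeasure g)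
      = densMeasure (fun x => ∫ u, f (x - u) * g u) := by
  have hfc := hf.continuous
  have : SFinite (densMeasure f) := by unfold densMeasure; infer_instance
  have : SFinite (densMeasure g) := by unfold densMeasure; infer_instance
  rw [Measure.conv_comm]
  unfold densMeasure
  rw [conv_withDensity_eq_lconvolution (by fun_prop) (by fun_prop)]
  congr 1
  funext x
  rw [lconvolution_def, ofReal_integral_eq_lintegral_ofReal (hf.integrable_conv hgi x)
    (ae_of_all _ fun u => mul_nonneg (hf0 _) (hg0 _))]
  refine lintegral_congr fun u => ?_
  rw [← ENNReal.ofReal_mul (hg0 u), mul_comm, neg_add_eq_sub]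

/-- Indices start at 1: the 0-th convolution power of the measure is a Dirac mass, without density,
and `convPow f 0` is a placeholder. -/
lemma convPow_spec {f : ℝ → ℝ} (h0 : ∀ x, 0 ≤ f x) (hi : Integrable f)
    (hf : ∀ m, ∃ C, BddDeriv m C f) (k : ℕ) :
    (∀ x, 0 ≤ convPow f (k + 1) x) ∧ (∀ m, ∃ C, BddDeriv m C (convPow f (k + 1))) ∧
      convMPow (densMeasure f) (k + 1) = densMeasure (convPow f (k + 1)) := by
  have hfc : Continuous f := (hf 0).choose_spec.1
  have : SFinite (densMeasure f) := by unfold densMeasure; infer_instance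
  induction k with
  | zero =>
    refine ⟨h0, hf, ?_⟩
    simp only [convMPow, convPow]
    exact Measure.dirac_zero_conv _
  | succ k ih =>
    obtain ⟨i1, i2, i3⟩ := ih
    have e : convPow f (k + 1 + 1) = fun x => ∫ u, convPow f (k + 1) (x - u) * f u := rfl
    rw [e]
    refine ⟨fun x => integral_nonneg fun u => mul_nonneg (i1 _) (h0 _), fun m => ?_, ?_⟩
    · obtain ⟨C, hC⟩ := i2 m
      exact ⟨_, hC.conv hi⟩
    · rw [show convMPow (densMeasure f) (k + 1 + 1)
        = Measure.conv (convMPow (densMeasure f) (k + 1)) (densMeasure f) from rfl, i3]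
      exact densMeasure_conv (i2 0).choose_spec i1 hfc h0 hi

lemma hasDerivAt_integral_Iic {φ : ℝ → ℝ} (hφ : Continuous φ) (hi : ∀ x, IntegrableOn φ (Set.Iic x))
    (x : ℝ) : HasDerivAt (fun x => ∫ v in Set.Iic x, φ v) (φ x) x := by
  have h1 : (fun x => ∫ v in Set.Iic x, φ v)
      = fun x => (∫ v in (0 : ℝ)..x, φ v) + ∫ v in Set.Iic (0 : ℝ), φ v := by
    funext x
    rw [← intervalIntegral.integral_Iic_sub_Iic (hi 0) (hi x)]
    ring
  rw [h1]
  exact (intervalIntegral.integral_hasDerivAt_right (hφ.intervalIntegrable _ _)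
    (hφ.stronglyMeasurableAtFilter _ _) hφ.continuousAt).add_const _

/-- Call prices of a smoothly distributed log-price grow slowly, with all their derivatives. -/
lemma growthBound_call {f : ℝ → ℝ} {m : ℕ} {C : ℝ} (h0 : ∀ x, 0 ≤ f x) (hi : Integrable f)
    (hf : BddDeriv m C f) (he : Integrable fun u => Real.exp u * f u) :
    GrowthBound (m + 1) ((∫ u, Real.exp u * f u) + m * C)
      (fun x => ∫ u, max (Real.exp (x + u) - 1) 0 * f u) := by
  set A := ∫ u, Real.exp u * f u
  have hA : 0 ≤ A := integral_nonneg fun u => mul_nonneg (Real.exp_pos u).le (h0 u)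
  have hC := hf.nonneg
  have hfc := hf.continuous
  set p : ℝ → ℝ := fun v => f (-v) with hp
  have hpc : Continuous p := by simp only [hp]; fun_prop
  have hp0 : ∀ v, 0 ≤ p v := fun v => h0 _
  have hpi : Integrable p := hi.comp_neg
  have hpe : Integrable fun v => Real.exp (-v) * p v := he.comp_neg
  have hpA : ∫ v, Real.exp (-v) * p v = A := integral_neg_eq_self (fun v => Real.exp v * f v) _
  -- V is the derivative of the call price in x. After reflection the kink of the payoff is an
  -- endpoint of integration, and V' = V + p lets the regularity of p bootstrap to V.
  set V : ℝ → ℝ := fun x => Real.exp x * ∫ v in Set.Iic x, Real.exp (-v) * p v with hV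
  have hV0 : ∀ x, 0 ≤ V x := fun x => mul_nonneg (Real.exp_pos x).le
    (integral_nonneg fun v => mul_nonneg (Real.exp_pos _).le (hp0 v))
  have hVb : ∀ x, V x ≤ A * weight x := by
    intro x
    have h1 : ∫ v in Set.Iic x, Real.exp (-v) * p v ≤ A := by
      rw [← hpA]
      exact setIntegral_le_integral hpe
        (ae_of_all _ fun v => mul_nonneg (Real.exp_pos _).le (hp0 v))
    calc V x ≤ Real.exp x * A := mul_le_mul_of_nonneg_left h1 (Real.exp_pos x).le
      _ ≤ A * weight x := by rw [mul_comm]; exact mul_le_mul_of_nonneg_left (exp_le_weight x) hA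
  have hVd : ∀ x, HasDerivAt V (V x + p x) x := by
    intro x
    have := (Real.hasDerivAt_exp x).mul (hasDerivAt_integral_Iic
      (φ := fun v => Real.exp (-v) * p v) (by fun_prop) (fun x => hpe.integrableOn) x)
    refine this.congr_deriv ?_
    rw [← mul_assoc, ← Real.exp_add]
    simp [hV]
  have hVg : ∀ k ≤ m, GrowthBound k (A + k * C) V := by
    have hpg : GrowthBound m C p := hf.comp_neg.1.growthBound
    intro k hk
    induction k with
    | zero =>
      refine ⟨continuous_iff_continuousAt.2 fun x => (hVd x).continuousAt, fun x => ?_⟩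
      rw [abs_of_nonneg (hV0 x)]
      simpa using hVb x
    | succ k ih =>
      have h1 := (ih (by omega)).add (hpg.of_le (m' := k) (by omega))
      refine GrowthBound.succ_of_hasDerivAt (fun x => ?_) hVd (h1.mono (le_of_eq ?_))
      · rw [abs_of_nonneg (hV0 x)]
        refine (hVb x).trans (mul_le_mul_of_nonneg_right ?_ (weight_pos x).le)
        have : 0 ≤ ((k + 1 : ℕ) : ℝ) * C := by positivity
        linarith
      · push_cast; ring
  have hH : (fun x => ∫ u, max (Real.exp (x + u) - 1) 0 * f u)
      = fun x => V x - ∫ v in Set.Iic x, p v := by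
    funext x
    rw [← integral_neg_eq_self, hV]
    simp only
    rw [← integral_const_mul, ← integral_sub (hpe.integrableOn.const_mul _) hpi.integrableOn,
      ← integral_indicator measurableSet_Iic]
    refine integral_congr_ae (ae_of_all _ fun v => ?_)
    by_cases hv : v ≤ x
    · have h1 : 0 ≤ Real.exp (x + -v) - 1 := by
        have := Real.one_le_exp (show 0 ≤ x + -v by linarith); linarith
      simp only [Set.mem_Iic, hv, Set.indicator_of_mem, max_eq_left h1, hp]
      rw [Real.exp_add]; ring
    · have h1 : Real.exp (x + -v) - 1 ≤ 0 := by
        have := Real.exp_le_one_iff.2 (show x + -v ≤ 0 by linarith); linarith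
      simp [hv, max_eq_right h1]
  have hHd : ∀ x, HasDerivAt (fun x => ∫ u, max (Real.exp (x + u) - 1) 0 * f u) (V x) x := by
    intro x
    rw [hH]
    exact ((hVd x).sub (hasDerivAt_integral_Iic hpc (fun x => hpi.integrableOn) x)).congr_deriv
      (by ring)
  refine GrowthBound.succ_of_hasDerivAt (fun x => ?_) hHd (hVg m le_rfl)
  have h1 : 0 ≤ ∫ u, max (Real.exp (x + u) - 1) 0 * f u :=
    integral_nonneg fun u => mul_nonneg (le_max_right _ _) (h0 u)
  have h2 : ∫ u, max (Real.exp (x + u) - 1) 0 * f u ≤ V x := by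
    rw [congrFun hH x]
    have : 0 ≤ ∫ v in Set.Iic x, p v := integral_nonneg fun v => hp0 v
    linarith
  rw [abs_of_nonneg h1]
  refine h2.trans ((hVb x).trans (mul_le_mul_of_nonneg_right ?_ (weight_pos x).le))
  have : 0 ≤ (m : ℝ) * C := by positivity
  linarith

/-- The weight is increasing, so a shift by z ≤ 0 keeps the same M. This is the source of uniformity
in z. -/
lemma GrowthBound.comp_const_add {m : ℕ} {M : ℝ} {g : ℝ → ℝ} (h : GrowthBound m M g) {z : ℝ}
    (hz : z ≤ 0) : GrowthBound m M (fun y => g (z + y)) := by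
  have hb : ∀ y, weight (z + y) ≤ weight y := fun y => by
    unfold weight; gcongr; linarith
  induction m generalizing g with
  | zero =>
    have hc := h.1
    exact ⟨by fun_prop, fun y => (h.bound _).trans (mul_le_mul_of_nonneg_left (hb y) h.nonneg)⟩
  | succ m ih =>
    exact succ_of_hasDerivAt
      (fun y => (h.bound _).trans (mul_le_mul_of_nonneg_left (hb y) h.nonneg))
      (fun y => (h.hasDerivAt (z + y)).comp_const_add z y) (ih h.deriv)

/-! ### Splitting the Lévy measure into small and big jumps. -/

/-- The small jumps `c(z) ν(dz)`. -/
def smallJumps (ν : Measure ℝ) (c : ℝ → ℝ) : Measure ℝ :=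
  ν.withDensity fun z => ENNReal.ofReal (c z)

/-- The big jumps `(1 - c(z)) ν(dz)`. -/
def bigJumps (ν : Measure ℝ) (c : ℝ → ℝ) : Measure ℝ :=
  ν.withDensity fun z => ENNReal.ofReal (1 - c z)

section Truncation

variable {ε : ℝ} {c : ℝ → ℝ}

lemma IsTruncation.nonneg (hc : IsTruncation ε c) (z : ℝ) : 0 ≤ c z :=
  (Set.indicator_nonneg (fun _ _ => zero_le_one) z).trans (hc.lower z)

lemma IsTruncation.le_one (hc : IsTruncation ε c) (z : ℝ) : c z ≤ 1 :=
  (hc.upper z).trans (Set.indicator_le_self' (fun _ _ => zero_le_one) z)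

lemma IsTruncation.eq_zero (hc : IsTruncation ε c) {z : ℝ} (hz : ε < |z|) : c z = 0 := by
  refine le_antisymm ((hc.upper z).trans (le_of_eq (Set.indicator_of_notMem ?_ _))) (hc.nonneg z)
  rw [Set.mem_Icc, ← abs_le]
  exact not_le.2 hz

lemma IsTruncation.eq_one (hc : IsTruncation ε c) {z : ℝ} (hz : |z| ≤ ε / 2) : c z = 1 := by
  refine le_antisymm (hc.le_one z) ?_
  have := hc.lower z
  rwa [Set.indicator_of_mem (by rw [Set.mem_Icc, ← abs_le]; exact hz)] at this

@[fun_prop]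
lemma IsTruncation.continuous (hc : IsTruncation ε c) : Continuous c := hc.contDiff.continuous

lemma IsTruncation.add_bigJumps (hc : IsTruncation ε c) (ν : Measure ℝ) :
    smallJumps ν c + bigJumps ν c = ν := by
  have hcc := hc.continuous
  unfold smallJumps bigJumps
  rw [← withDensity_add_left (by fun_prop)]
  have : ((fun z => ENNReal.ofReal (c z)) + fun z => ENNReal.ofReal (1 - c z)) = 1 := by
    funext z
    simp only [Pi.add_apply, Pi.one_apply]
    rw [← ENNReal.ofReal_add (hc.nonneg z) (by linarith [hc.le_one z])]
    simp
  rw [this, withDensity_one]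

lemma IsTruncation.integral_smallJumps {E : Type*} [NormedAddCommGroup E] [NormedSpace ℝ E]
    (hc : IsTruncation ε c) (ν : Measure ℝ) (g : ℝ → E) :
    ∫ z, g z ∂(smallJumps ν c) = ∫ z, c z • g z ∂ν := by
  have hcc := hc.continuous
  unfold smallJumps
  rw [integral_withDensity_eq_integral_toReal_smul (by fun_prop)
    (ae_of_all _ fun x => ENNReal.ofReal_lt_top)]
  simp_rw [ENNReal.toReal_ofReal (hc.nonneg _)]

lemma IsTruncation.integral_bigJumps {E : Type*} [NormedAddCommGroup E] [NormedSpace ℝ E]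
    (hc : IsTruncation ε c) (ν : Measure ℝ) (g : ℝ → E) :
    ∫ z, g z ∂(bigJumps ν c) = ∫ z, (1 - c z) • g z ∂ν := by
  have hcc := hc.continuous
  unfold bigJumps
  rw [integral_withDensity_eq_integral_toReal_smul (by fun_prop)
    (ae_of_all _ fun x => ENNReal.ofReal_lt_top)]
  simp_rw [ENNReal.toReal_ofReal (sub_nonneg.2 (hc.le_one _))]

lemma IsTruncation.ae_smallJumps (hc : IsTruncation ε c) (ν : Measure ℝ) :
    ∀ᵐ z ∂(smallJumps ν c), |z| ≤ ε := by
  have hcc := hc.continuous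
  unfold smallJumps
  rw [ae_withDensity_iff (by fun_prop)]
  refine ae_of_all _ fun z hz => ?_
  by_contra h
  exact hz (by simp [hc.eq_zero (not_le.1 h)])

lemma IsTruncation.isSmallJump (hc : IsTruncation ε c) (hε1 : ε < 1) {ν : Measure ℝ}
    (hν : IsLevyMeasure ν) : IsSmallJump (smallJumps ν c) := by
  have hcc := hc.continuous
  refine ⟨(hc.ae_smallJumps ν).mono fun z hz => hz.trans hε1.le, by fun_prop, ?_⟩
  rw [hasFiniteIntegral_iff_ofReal (ae_of_all _ fun z => sq_nonneg z), smallJumps,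
    lintegral_withDensity_eq_lintegral_mul _ (by fun_prop) (by fun_prop)]
  refine (lintegral_mono fun z => ?_).trans_lt hν.2
  simp only [Pi.mul_apply]
  rw [← ENNReal.ofReal_mul (hc.nonneg z)]
  refine ENNReal.ofReal_le_ofReal ?_
  by_cases hz : ε < |z|
  · rw [hc.eq_zero hz, zero_mul]; exact le_min zero_le_one (sq_nonneg z)
  · have h1 : z ^ 2 ≤ 1 := (sq_le_one_iff_abs_le_one z).2 ((not_lt.1 hz).trans hε1.le)
    rw [min_eq_right h1]
    exact mul_le_of_le_one_left (sq_nonneg z) (hc.le_one z)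

lemma IsTruncation.isFiniteMeasure_bigJumps (hc : IsTruncation ε c) (hε : 0 < ε) (hε1 : ε < 1)
    {ν : Measure ℝ} (hν : IsLevyMeasure ν) : IsFiniteMeasure (bigJumps ν c) := by
  have hcc := hc.continuous
  refine ⟨?_⟩
  rw [bigJumps, withDensity_apply _ MeasurableSet.univ, Measure.restrict_univ]
  -- Where |z| ≤ ε/2 the left side is 0; elsewhere min(1, z²) ≥ ε²/4, whence the constant 4/ε².
  have h1 : ∀ z, ENNReal.ofReal (1 - c z)
      ≤ ENNReal.ofReal (4 / ε ^ 2) * ENNReal.ofReal (min 1 (z ^ 2)) := by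
    intro z
    rw [← ENNReal.ofReal_mul (by positivity)]
    refine ENNReal.ofReal_le_ofReal ?_
    by_cases hz : |z| ≤ ε / 2
    · rw [hc.eq_one hz, sub_self]
      exact mul_nonneg (by positivity) (le_min zero_le_one (sq_nonneg z))
    · have h2 : ε ^ 2 / 4 ≤ min 1 (z ^ 2) := by
        refine le_min (by nlinarith) ?_
        rw [← sq_abs z]
        nlinarith [not_le.1 hz]
      calc 1 - c z ≤ 1 := by linarith [hc.nonneg z]
        _ = 4 / ε ^ 2 * (ε ^ 2 / 4) := by field_simp
        _ ≤ _ := mul_le_mul_of_nonneg_left h2 (by positivity)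
  refine (lintegral_mono h1).trans_lt ?_
  rw [lintegral_const_mul _ (by fun_prop)]
  exact ENNReal.mul_lt_top ENNReal.ofReal_lt_top hν.2

lemma IsTruncation.integrable_exp_bigJumps (hc : IsTruncation ε c) (hε : 0 < ε) (hε1 : ε < 1)
    {ν : Measure ℝ} (hν : IsLevyMeasure ν) (hexp : HasExpMoment ν) :
    Integrable (fun z => Real.exp (2 * z)) (bigJumps ν c) := by
  have hcc := hc.continuous
  have := hc.isFiniteMeasure_bigJumps hε hε1 hν
  obtain ⟨C, hC, hfin⟩ := hexp
  have hm : MeasurableSet {z : ℝ | 1 < |z|} := measurableSet_lt measurable_const (by fun_prop)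
  refine ⟨by fun_prop, ?_⟩
  rw [hasFiniteIntegral_iff_ofReal (ae_of_all _ fun z => (Real.exp_pos _).le),
    -- Beyond |z| = 1 the exponential moment of order above 2 applies; inside, the integrand is at
    -- most e² and the mass is finite.
    ← lintegral_add_compl _ hm]
  refine ENNReal.add_lt_top.2 ⟨?_, ?_⟩
  · refine lt_of_le_of_lt ?_ hfin
    refine (lintegral_mono (g := fun z => ENNReal.ofReal (Real.exp (C * |z|))) fun z => ?_).trans
      (lintegral_mono' (Measure.restrict_mono_measure ?_ _) le_rfl)
    · refine ENNReal.ofReal_le_ofReal (Real.exp_le_exp.2 ?_)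
      nlinarith [le_abs_self z, abs_nonneg z]
    · nth_rewrite 2 [← hc.add_bigJumps ν]
      exact Measure.le_add_left le_rfl
  · refine (setLIntegral_mono' (g := fun _ => ENNReal.ofReal (Real.exp 2)) hm.compl
      fun z hz => ?_).trans_lt ?_
    · have hz' : |z| ≤ 1 := by simpa using hz
      refine ENNReal.ofReal_le_ofReal (Real.exp_le_exp.2 ?_)
      linarith [le_abs_self z]
    · rw [lintegral_const]
      exact ENNReal.mul_lt_top ENNReal.ofReal_lt_top (measure_lt_top _ _)

lemma IsTruncation.jumpIntensity_eq (hc : IsTruncation ε c) (ν : Measure ℝ) :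
    jumpIntensity ν c = (bigJumps ν c).real Set.univ := by
  have := hc.integral_bigJumps ν (fun _ => (1 : ℝ))
  simp only [integral_const, smul_eq_mul, mul_one] at this
  exact this.symm

/-- Since c vanishes for |z| > ε and ε < 1, the cutoff in the compensator is invisible to the small
jumps. -/
lemma IsTruncation.smallJumpGenerator_eq (hc : IsTruncation ε c) (hε1 : ε < 1) (b σ : ℝ)
    (ν : Measure ℝ) :
    smallJumpGenerator b σ ν c
      = levyOp (truncatedDrift b ν c) (σ ^ 2 / 2) (smallJumps ν c) := by
  funext g y
  unfold smallJumpGenerator levyOp taylorOp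
  rw [iteratedDeriv_succ, iteratedDeriv_one, hc.integral_smallJumps]
  congr 1
  refine integral_congr_ae (ae_of_all _ fun z => ?_)
  by_cases hz : |z| ≤ 1
  · simp only [smul_eq_mul]
    rw [Set.indicator_of_mem (by exact hz)]
    simp only [Pi.one_apply]
    ring
  · simp [hc.eq_zero (hε1.trans (not_le.1 hz))]

/-- The big jumps need no compensation: their compensator is integrable and moves into the drift,
turning b into b_ε. What remains of them is a compound Poisson exponent. -/
lemma IsTruncation.levyExponent_eq (hc : IsTruncation ε c) (hε : 0 < ε) (hε1 : ε < 1) (b σ : ℝ)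
    {ν : Measure ℝ} (hν : IsLevyMeasure ν) (u : ℝ) :
    levyExponent b σ ν u
      = ((truncatedDrift b ν c : ℝ) * u * Complex.I - (σ ^ 2 / 2 : ℝ) * u ^ 2
        + ∫ z : ℝ, (Complex.exp (u * z * Complex.I) - 1 - u * z * Complex.I) ∂(smallJumps ν c))
        + (charFun (bigJumps ν c) u - ((bigJumps ν c).real Set.univ : ℂ)) := by
  have hfin := hc.isFiniteMeasure_bigJumps hε hε1 hν
  have hκ := hc.isSmallJump hε1 hν
  have hm : MeasurableSet {x : ℝ | |x| ≤ 1} := measurableSet_le (by fun_prop) measurable_const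
  set F : ℝ → ℂ := fun z => Complex.exp (Complex.I * (u * z : ℝ)) - 1
        - Complex.I * ((u * z * Set.indicator {x : ℝ | |x| ≤ 1} 1 z : ℝ) : ℂ) with hF
  have hF1 : (fun z : ℝ => Complex.exp (u * z * Complex.I) - 1 - u * z * Complex.I)
      =ᵐ[smallJumps ν c] F := by
    filter_upwards [hκ.1] with z hz
    simp only [hF]
    rw [Set.indicator_of_mem (by exact hz), mul_comm Complex.I]
    push_cast
    simp
    ring
  have hi1 : Integrable F (smallJumps ν c) := (hκ.integrable_cexp u).congr hF1
  have he : Integrable (fun x : ℝ => Complex.exp (u * x * Complex.I)) (bigJumps ν c) := by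
    refine Integrable.of_bound (C := 1) (by fun_prop) (ae_of_all _ fun x => ?_)
    rw [← Complex.ofReal_mul, Complex.norm_exp_ofReal_mul_I]
  have hz1 : Integrable (Set.indicator {x : ℝ | |x| ≤ 1} fun z => z) (bigJumps ν c) := by
    refine Integrable.of_bound (C := 1) (measurable_id.indicator hm).aestronglyMeasurable
      (ae_of_all _ fun z => ?_)
    by_cases hz : |z| ≤ 1 <;> simp [hz]
  have hF2 : F = fun z : ℝ => (Complex.exp (u * z * Complex.I) - 1)
      - (u * Complex.I) * ((Set.indicator {x : ℝ | |x| ≤ 1} (fun z => z) z : ℝ) : ℂ) := by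
    funext z
    simp only [hF]
    rw [mul_comm Complex.I]
    by_cases hz : |z| ≤ 1
    · simp [hz]; ring
    · simp [hz]
  have hi2 : Integrable F (bigJumps ν c) := by
    rw [hF2]
    exact (he.sub (integrable_const _)).sub (hz1.ofReal.const_mul _)
  have hI2 : ∫ z, F z ∂(bigJumps ν c) = (charFun (bigJumps ν c) u - ((bigJumps ν c).real Set.univ : ℂ))
      - (u * Complex.I) * ((∫ z in {z : ℝ | |z| ≤ 1}, z * (1 - c z) ∂ν : ℝ) : ℂ) := by
    have he1 : Integrable (fun x : ℝ => Complex.exp (u * x * Complex.I) - 1) (bigJumps ν c) :=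
      he.sub (integrable_const _)
    have hz2 : Integrable (fun z : ℝ => (u * Complex.I) *
        ((Set.indicator {x : ℝ | |x| ≤ 1} (fun z => z) z : ℝ) : ℂ)) (bigJumps ν c) :=
      hz1.ofReal.const_mul _
    rw [hF2, integral_sub he1 hz2, integral_sub he (integrable_const _), integral_const_mul, integral_complex_ofReal,
      charFun_apply_real, hc.integral_bigJumps ν (Set.indicator {x : ℝ | |x| ≤ 1} fun z => z),
      ← integral_indicator hm]
    have : ∀ z, (1 - c z) • Set.indicator {x : ℝ | |x| ≤ 1} (fun z => z) z
        = Set.indicator {z : ℝ | |z| ≤ 1} (fun z => z * (1 - c z)) z := by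
      intro z
      by_cases hz : |z| ≤ 1 <;> simp [hz, mul_comm]
    simp_rw [this]
    simp
  have hI : ∫ z, F z ∂ν = ∫ z, F z ∂(smallJumps ν c) + ∫ z, F z ∂(bigJumps ν c) := by
    rw [← integral_add_measure hi1 hi2, hc.add_bigJumps]
  unfold levyExponent
  rw [show (∫ z, (Complex.exp (Complex.I * (u * z : ℝ)) - 1
        - Complex.I * ((u * z * Set.indicator {x : ℝ | |x| ≤ 1} 1 z : ℝ) : ℂ)) ∂ν) = ∫ z, F z ∂ν
        from rfl, hI, hI2, integral_congr_ae hF1]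
  unfold truncatedDrift
  push_cast
  ring

variable {ν : Measure ℝ} {s : ℝ → ℝ}

lemma IsTruncation.bigDensity_nonneg (hc : IsTruncation ε c) (hε : 0 < ε)
    (hs : HasSmoothDensity ν s) (v : ℝ) : 0 ≤ (1 - c v) * s v := by
  rcases eq_or_ne v 0 with rfl | hv
  · rw [hc.eq_one (by simpa using (half_pos hε).le)]; simp
  · exact mul_nonneg (sub_nonneg.2 (hc.le_one v)) (hs.nonneg v hv)

lemma HasSmoothDensity.measurable (hs : HasSmoothDensity ν s) : Measurable s :=
  measurable_of_continuousOn_compl_singleton 0 hs.contDiffOn.continuousOn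

lemma IsTruncation.bigJumps_eq (hc : IsTruncation ε c) (hs : HasSmoothDensity ν s) :
    bigJumps ν c = densMeasure (fun v => (1 - c v) * s v) := by
  have hcc := hc.continuous
  have hsm := hs.measurable
  unfold bigJumps densMeasure
  conv_lhs => rw [hs.eq_withDensity]
  rw [← withDensity_mul _ (by fun_prop) (by fun_prop)]
  congr 1
  funext v
  simp only [Pi.mul_apply]
  rw [mul_comm, ← ENNReal.ofReal_mul (sub_nonneg.2 (hc.le_one v))]

/-- The factor 1 - c vanishes on a whole neighbourhood of 0 and removes the singularity of s there.
-/
lemma IsTruncation.contDiff_bigDensity (hc : IsTruncation ε c) (hε : 0 < ε)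
    (hs : HasSmoothDensity ν s) : ContDiff ℝ ∞ (fun v => (1 - c v) * s v) := by
  rw [contDiff_iff_contDiffAt]
  intro v
  rcases eq_or_ne v 0 with rfl | hv
  · refine (contDiffAt_const (c := (0 : ℝ))).congr_of_eventuallyEq ?_
    filter_upwards [Metric.ball_mem_nhds (0 : ℝ) (half_pos hε)] with v hv
    rw [hc.eq_one (by simpa using (Metric.mem_ball.1 hv).le)]
    simp
  · exact (contDiffAt_const.sub hc.contDiff.contDiffAt).mul
      (hs.contDiffOn.contDiffAt (isOpen_compl_singleton.mem_nhds hv))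

lemma IsTruncation.bddDeriv_bigDensity (hc : IsTruncation ε c) (hε : 0 < ε)
    (hs : HasSmoothDensity ν s) (m : ℕ) : ∃ C, BddDeriv m C (fun v => (1 - c v) * s v) := by
  have hsm := hc.contDiff_bigDensity hε hs
  have h1 : ∀ k : ℕ, ∃ C, ∀ x, |iteratedDeriv k (fun v => (1 - c v) * s v) x| ≤ C := by
    intro k
    obtain ⟨C₁, hC₁⟩ := hs.bounded k ε hε
    obtain ⟨C₂, hC₂⟩ := (isCompact_Icc (a := -ε) (b := ε)).exists_bound_of_continuousOn
      (hsm.continuous_iteratedDeriv k (by exact_mod_cast le_top)).continuousOn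
    refine ⟨max C₁ C₂, fun x => ?_⟩
    -- Outside [-ε, ε] the density coincides with s; inside, compactness bounds each derivative.
    by_cases hx : ε < |x|
    · refine le_max_of_le_left ?_
      have : (fun v => (1 - c v) * s v) =ᶠ[𝓝 x] s := by
        filter_upwards [(isOpen_lt continuous_const continuous_abs).mem_nhds hx] with v hv
        rw [hc.eq_zero hv]; ring
      rw [this.iteratedDeriv_eq]
      exact hC₁ x hx
    · exact le_max_of_le_right (hC₂ x (abs_le.1 (not_lt.1 hx)))
  choose B hB using h1
  refine ⟨∑ k ∈ Finset.range (m + 1), |B k|, BddDeriv.of_iteratedDeriv hsm fun k hk x => ?_⟩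
  refine (hB k x).trans ((le_abs_self _).trans ?_)
  exact Finset.single_le_sum (f := fun k => |B k|) (fun _ _ => abs_nonneg _)
    (Finset.mem_range.2 (by omega))

end Truncation

/-! ### Passage to the limit under weak convergence. -/

section WeakLimit

/-- Convergence in law preserves a uniform bound on the second exponential moment. -/
lemma integrable_exp_of_tendsto {μ : ℕ → ProbabilityMeasure ℝ} {μ₀ : ProbabilityMeasure ℝ}
    (hμ : Tendsto μ atTop (𝓝 μ₀)) {K : ℝ}
    (hi : ∀ n, Integrable (fun x => Real.exp (2 * x)) (μ n : Measure ℝ))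
    (hK : ∀ n, ∫ x, Real.exp (2 * x) ∂(μ n : Measure ℝ) ≤ K) :
    Integrable (fun x => Real.exp (2 * x)) (μ₀ : Measure ℝ) ∧
      ∫ x, Real.exp (2 * x) ∂(μ₀ : Measure ℝ) ≤ K := by
  have h0 : 0 ≤ K := (integral_nonneg fun x => (Real.exp_pos _).le).trans (hK 0)
  -- Fatou's inequality along weak convergence, from the portmanteau bound on open sets.
  have h1 := lintegral_le_liminf_lintegral_of_forall_isOpen_measure_le_liminf_measure
    (μ := (μ₀ : Measure ℝ)) (μs := fun n => (μ n : Measure ℝ)) (f := fun x => Real.exp (2 * x))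
    (by fun_prop) (fun x => (Real.exp_pos _).le)
    fun G hG => ProbabilityMeasure.le_liminf_measure_open_of_tendsto hμ hG
  have h2 : ∫⁻ x, ENNReal.ofReal (Real.exp (2 * x)) ∂(μ₀ : Measure ℝ) ≤ ENNReal.ofReal K := by
    refine h1.trans ?_
    refine (liminf_le_liminf (v := fun _ => ENNReal.ofReal K)
      (Eventually.of_forall fun n => ?_)).trans (by simp)
    rw [← ofReal_integral_eq_lintegral_ofReal (hi n) (ae_of_all _ fun x => (Real.exp_pos _).le)]
    exact ENNReal.ofReal_le_ofReal (hK n)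
  have h3 : Integrable (fun x => Real.exp (2 * x)) (μ₀ : Measure ℝ) := by
    refine ⟨by fun_prop, ?_⟩
    rw [hasFiniteIntegral_iff_ofReal (ae_of_all _ fun x => (Real.exp_pos _).le)]
    exact h2.trans_lt ENNReal.ofReal_lt_top
  refine ⟨h3, ?_⟩
  rw [← ofReal_integral_eq_lintegral_ofReal h3 (ae_of_all _ fun x => (Real.exp_pos _).le)] at h2
  exact (ENNReal.ofReal_le_ofReal_iff h0).1 h2

/-- Convergence in law with bounded second exponential moments implies convergence of the
expectations of functions of exponential growth of order one. -/
lemma tendsto_integral_of_le_exp {μ : ℕ → ProbabilityMeasure ℝ} {μ₀ : ProbabilityMeasure ℝ}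
    (hμ : Tendsto μ atTop (𝓝 μ₀)) {K : ℝ}
    (hi : ∀ n, Integrable (fun x => Real.exp (2 * x)) (μ n : Measure ℝ))
    (hK : ∀ n, ∫ x, Real.exp (2 * x) ∂(μ n : Measure ℝ) ≤ K) {f : ℝ → ℝ} (hf : Continuous f)
    (hf0 : ∀ x, 0 ≤ f x) (hf1 : ∀ x, f x ≤ Real.exp x) :
    Tendsto (fun n => ∫ x, f x ∂(μ n : Measure ℝ)) atTop (𝓝 (∫ x, f x ∂(μ₀ : Measure ℝ))) := by
  have hK0 : 0 ≤ K := (integral_nonneg fun x => (Real.exp_pos _).le).trans (hK 0)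
  obtain ⟨hi₀, hK₀⟩ := integrable_exp_of_tendsto hμ hi hK
  -- Truncating f at R costs at most f²/R ≤ e^{2x}/R pointwise, so the error is at most K/R for
  -- every law involved.
  have key : ∀ (ρ : ProbabilityMeasure ℝ) (R : ℝ), 0 < R →
      Integrable (fun x => Real.exp (2 * x)) (ρ : Measure ℝ) →
      ∫ x, Real.exp (2 * x) ∂(ρ : Measure ℝ) ≤ K →
      |∫ x, f x ∂(ρ : Measure ℝ) - ∫ x, min (f x) R ∂(ρ : Measure ℝ)| ≤ K / R := by
    intro ρ R hR hρ hρK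
    have hfi : Integrable f (ρ : Measure ℝ) := by
      refine (integrable_weight hρ).mono' hf.aestronglyMeasurable (ae_of_all _ fun x => ?_)
      rw [Real.norm_eq_abs, abs_of_nonneg (hf0 x)]
      exact (hf1 x).trans (exp_le_weight x)
    have hmi : Integrable (fun x => min (f x) R) (ρ : Measure ℝ) :=
      hfi.mono' (by fun_prop) (ae_of_all _ fun x => by
        rw [Real.norm_eq_abs, abs_of_nonneg (le_min (hf0 x) hR.le)]; exact min_le_left _ _)
    rw [← integral_sub hfi hmi, ← Real.norm_eq_abs]
    refine (norm_integral_le_of_norm_le (hρ.div_const R) (ae_of_all _ fun x => ?_)).trans ?_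
    · rw [Real.norm_eq_abs, abs_of_nonneg (sub_nonneg.2 (min_le_left _ _)), le_div_iff₀ hR]
      have h2 : Real.exp (2 * x) = Real.exp x * Real.exp x := by rw [← Real.exp_add]; ring_nf
      have h3 : f x * f x ≤ Real.exp (2 * x) := by
        rw [h2]; exact mul_le_mul (hf1 x) (hf1 x) (hf0 x) (Real.exp_pos _).le
      rcases le_total (f x) R with h | h
      · rw [min_eq_left h]; simp [(Real.exp_pos _).le]
      · rw [min_eq_right h]; nlinarith [hf0 x]
    · rw [integral_div]; gcongr
  rw [Metric.tendsto_atTop]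
  intro δ hδ
  set R := 4 * (K + 1) / δ with hRdef
  have hR : 0 < R := by positivity
  have hKR : K / R ≤ δ / 4 := by
    rw [div_le_iff₀ hR, hRdef]
    field_simp
    linarith
  set F : BoundedContinuousFunction ℝ ℝ := BoundedContinuousFunction.ofNormedAddCommGroup
    (fun x => min (f x) R) (by fun_prop) R (fun x => by
      rw [Real.norm_eq_abs, abs_of_nonneg (le_min (hf0 x) hR.le)]; exact min_le_right _ _)
  have ht := (ProbabilityMeasure.tendsto_iff_forall_integral_tendsto.1 hμ) F
  obtain ⟨N, hN⟩ := Metric.tendsto_atTop.1 ht (δ / 2) (by positivity)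
  refine ⟨N, fun n hn => ?_⟩
  have h1 : |∫ x, min (f x) R ∂(μ n : Measure ℝ) - ∫ x, min (f x) R ∂(μ₀ : Measure ℝ)| < δ / 2 :=
    hN n hn
  have h2 := key (μ n) R hR (hi n) (hK n)
  have h3 := key μ₀ R hR hi₀ hK₀
  rw [Real.dist_eq]
  rw [abs_le] at h2 h3
  rw [abs_lt] at h1 ⊢
  constructor <;> linarith [h1.1, h1.2, h2.1, h2.2, h3.1, h3.2]

end WeakLimit

/-! ### The payoff and its smooth majorant. -/

/-- The shape (zero on the left, exponential on the right) is inherited by the derivative, and the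
middle interval is compact. -/
lemma exists_growthBound_of_eq_exp {a b : ℝ} {g : ℝ → ℝ} (hg : ContDiff ℝ ∞ g)
    (h0 : ∀ y < a, g y = 0) (h1 : ∀ y, b < y → g y = Real.exp y) (m : ℕ) :
    ∃ M, GrowthBound m M g := by
  have hb : ∀ {g : ℝ → ℝ}, Continuous g → (∀ y < a, g y = 0) →
      (∀ y, b < y → g y = Real.exp y) → ∃ M, ∀ y, |g y| ≤ M * weight y := by
    intro g hg h0 h1
    obtain ⟨C, hC⟩ := (isCompact_Icc (a := a) (b := b)).exists_bound_of_continuousOn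
      hg.continuousOn
    refine ⟨max C 1, fun y => ?_⟩
    have hw := one_le_weight y
    have hw0 := weight_pos y
    have hm1 : 1 ≤ max C 1 := le_max_right _ _
    by_cases hy : y < a
    · rw [h0 y hy, abs_zero]; positivity
    · by_cases hy' : b < y
      · rw [h1 y hy', abs_of_pos (Real.exp_pos y)]
        exact (exp_le_weight y).trans (le_mul_of_one_le_left hw0.le hm1)
      · refine ((hC y ⟨not_lt.1 hy, not_lt.1 hy'⟩).trans (le_max_left C 1)).trans ?_
        exact le_mul_of_one_le_right (by positivity) hw
  obtain ⟨M, hM⟩ := hb hg.continuous h0 h1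
  induction m generalizing g M with
  | zero => exact ⟨M, hg.continuous, hM⟩
  | succ m ih =>
    have hg' := contDiff_infty_iff_deriv.1 hg
    have h0' : ∀ y < a, deriv g y = 0 := fun y hy => by
      have : g =ᶠ[𝓝 y] fun _ => (0 : ℝ) := by
        filter_upwards [Iio_mem_nhds hy] with x hx using h0 x hx
      rw [this.deriv_eq]; simp
    have h1' : ∀ y, b < y → deriv g y = Real.exp y := fun y hy => by
      have : g =ᶠ[𝓝 y] Real.exp := by
        filter_upwards [Ioi_mem_nhds hy] with x hx using h1 x hx
      rw [this.deriv_eq]; simp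
    obtain ⟨M₁, hM₁⟩ := hb hg'.2.continuous h0' h1'
    obtain ⟨M₂, hM₂⟩ := ih hg'.2 h0' h1' M₁ hM₁
    exact ⟨max M M₂, fun y => (hM y).trans
      (mul_le_mul_of_nonneg_right (le_max_left _ _) (weight_pos y).le), hg'.1,
      hM₂.mono (le_max_right _ _)⟩

/-- A smooth majorant of the exponential on `[2a, ∞)` that vanishes on `(-∞, a)`. -/
lemma exists_smooth_majorant {a : ℝ} (ha : 0 < a) : ∃ φ : ℝ → ℝ, (∀ y, 0 ≤ φ y) ∧
    (∀ y < a, φ y = 0) ∧ (∀ y, 2 * a ≤ y → φ y = Real.exp y) ∧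
    ∀ m, ∃ M, GrowthBound m M φ := by
  set φ : ℝ → ℝ := fun y => Real.smoothTransition ((y - a) / a) * Real.exp y with hφ
  have h0 : ∀ y < a, φ y = 0 := fun y hy => by
    simp only [hφ]
    rw [Real.smoothTransition.zero_of_nonpos (div_nonpos_of_nonpos_of_nonneg (by linarith) ha.le),
      zero_mul]
  have h1 : ∀ y, 2 * a ≤ y → φ y = Real.exp y := fun y hy => by
    simp only [hφ]
    rw [Real.smoothTransition.one_of_one_le (by rw [le_div_iff₀ ha]; linarith), one_mul]
  refine ⟨φ, fun y => mul_nonneg (Real.smoothTransition.nonneg _) (Real.exp_pos y).le, h0, h1,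
    exists_growthBound_of_eq_exp (b := 2 * a) ?_ h0 fun y hy => h1 y hy.le⟩
  exact (Real.smoothTransition.contDiff.comp (by fun_prop)).mul Real.contDiff_exp

/-- The payoff `(e^x - 1)₊` of a call option, at log-moneyness `z`. -/
def call (z x : ℝ) : ℝ := max (Real.exp (z + x) - 1) 0

lemma call_nonneg (z x : ℝ) : 0 ≤ call z x := le_max_right _ _

lemma call_le_exp {z : ℝ} (hz : z ≤ 0) (x : ℝ) : call z x ≤ Real.exp x := by
  refine max_le ?_ (Real.exp_pos x).le
  have : Real.exp (z + x) ≤ Real.exp x := Real.exp_le_exp.2 (by linarith)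
  linarith

lemma call_eq_zero {z x : ℝ} (h : z + x ≤ 0) : call z x = 0 :=
  max_eq_right (by linarith [Real.exp_le_one_iff.2 h])

lemma continuous_call (z : ℝ) : Continuous (call z) := by unfold call; fun_prop

lemma integrable_exp_conv {μ ρ : Measure ℝ} [IsFiniteMeasure μ] [IsFiniteMeasure ρ] {θ : ℝ}
    (hμ : Integrable (fun x => Real.exp (θ * x)) μ)
    (hρ : Integrable (fun x => Real.exp (θ * x)) ρ) :
    Integrable (fun x => Real.exp (θ * x)) (Measure.conv μ ρ) := by
  rw [integrable_conv_iff (by fun_prop)]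
  simp only [mul_add, Real.exp_add, norm_mul, Real.norm_eq_abs, Real.abs_exp]
  refine ⟨ae_of_all _ fun x => hρ.const_mul _, ?_⟩
  simp_rw [integral_const_mul]
  exact hμ.mul_const _

lemma integral_exp_conv {μ ρ : Measure ℝ} [IsFiniteMeasure μ] [IsFiniteMeasure ρ] {θ : ℝ}
    (hμ : Integrable (fun x => Real.exp (θ * x)) μ)
    (hρ : Integrable (fun x => Real.exp (θ * x)) ρ) :
    ∫ x, Real.exp (θ * x) ∂(Measure.conv μ ρ)
      = (∫ x, Real.exp (θ * x) ∂μ) * ∫ x, Real.exp (θ * x) ∂ρ := by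
  rw [integral_conv (integrable_exp_conv hμ hρ)]
  simp only [mul_add, Real.exp_add]
  simp_rw [integral_const_mul]
  rw [integral_mul_const]

lemma integrable_exp_one {μ : Measure ℝ} [IsFiniteMeasure μ]
    (h : Integrable (fun x => Real.exp (2 * x)) μ) : Integrable (fun x => Real.exp (1 * x)) μ :=
  (integrable_weight h).mono' (by fun_prop) (ae_of_all _ fun x => by
    rw [Real.norm_eq_abs, Real.abs_exp, one_mul]; exact exp_le_weight x)

lemma integrable_call {μ : Measure ℝ} [IsFiniteMeasure μ]
    (h : Integrable (fun x => Real.exp (2 * x)) μ) {z : ℝ} (hz : z ≤ 0) :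
    Integrable (call z) μ :=
  (integrable_exp_one h).mono' (continuous_call z).aestronglyMeasurable (ae_of_all _ fun x => by
    rw [Real.norm_eq_abs, abs_of_nonneg (call_nonneg z x), one_mul]; exact call_le_exp hz x)

/-- Conditioning on the number of jumps of the second component. -/
lemma hasSum_integral_conv_compoundPoisson {μ β : Measure ℝ} [IsFiniteMeasure μ] [IsFiniteMeasure β]
    {t : ℝ} (ht : 0 ≤ t) {f : ℝ → ℝ} (hf : Integrable f (Measure.conv μ (compoundPoisson β t)))
    (hfk : ∀ k, Integrable f (Measure.conv μ (convMPow β k))) :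
    HasSum (fun k : ℕ => Real.exp (-(t * β.real Set.univ)) *
        ((t ^ k / k.factorial) * ∫ x, f x ∂(Measure.conv μ (convMPow β k))))
      (∫ x, f x ∂(Measure.conv μ (compoundPoisson β t))) := by
  have := isProbabilityMeasure_compoundPoisson β ht
  rw [Measure.conv_comm] at hf ⊢
  have h1 : Integrable (fun u => ∫ x, f (u + x) ∂μ) (compoundPoisson β t) := by
    rw [Measure.conv, integrable_map_measure (by simpa [Measure.conv] using hf.1)
      (by fun_prop)] at hf
    exact hf.integral_prod_left
  have h2 := hasSum_integral_compoundPoisson β ht h1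
  rw [integral_conv hf]
  refine h2.congr_fun ?_
  intro k
  have h3 := hfk k
  rw [Measure.conv_comm] at h3
  rw [Measure.conv_comm, integral_conv h3]
  simp

lemma exists_seq_tendsto_nhdsGT_zero {ε : ℝ} (hε : 0 < ε) :
    ∃ h : ℕ → ℝ, (∀ N, 0 < h N) ∧ (∀ N, h N ≤ ε) ∧ Tendsto h atTop (𝓝[>] 0) := by
  set h : ℕ → ℝ := fun N => ε * (1 / ((N : ℝ) + 1)) with hh
  have hpos : ∀ N, 0 < h N := fun N => by simp only [hh]; positivity
  have hle : ∀ N, h N ≤ ε := fun N => mul_le_of_le_one_right hε.le (by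
    rw [div_le_one (by positivity)]; linarith [(N.cast_nonneg : (0 : ℝ) ≤ N)])
  have hlim : Tendsto h atTop (𝓝[>] 0) := by
    refine tendsto_nhdsWithin_iff.2 ⟨?_, Eventually.of_forall hpos⟩
    simpa [hh] using tendsto_one_div_add_atTop_nhds_zero_nat.const_mul ε
  exact ⟨h, hpos, hle, hlim⟩

/-! ### The expansion, first for the approximations and then in the limit. -/

section Expansion

variable {κ β : Measure ℝ} [IsFiniteMeasure β]

/-- The approximating laws satisfy the expansion, with a constant independent of `h`. -/
lemma IsSmallJump.exists_abs_integral_call_sub_le (hκ : IsSmallJump κ) {ε : ℝ} (hε : 0 < ε)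
    (hε1 : ε ≤ 1) (hsupp : ∀ᵐ z ∂κ, |z| ≤ ε) (a : ℝ) {q : ℝ} (hq : 0 ≤ q)
    (hβ : Integrable (fun x => Real.exp (2 * x)) β) (n : ℕ) {z₀ : ℝ}
    (hz₀ : z₀ ≤ -(2 * ((n + 1 : ℕ) * ε))) (H : ℕ → ℝ → ℝ → ℝ)
    (hH : ∀ k, 1 ≤ k → ∀ z y, ∫ u, call z (y + u) ∂(convMPow β k) = H k z y)
    (hHb : ∀ k, 1 ≤ k → ∀ m, ∃ M, ∀ z ≤ 0, GrowthBound m M (H k z)) :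
    ∃ C, ∀ z < z₀, ∀ h, 0 < h → h ≤ ε → ∀ t, 0 ≤ t → t ≤ 1 →
      |∫ x, call z x ∂(Measure.conv (compoundPoisson (approxMeasure a q κ h) t)
          (compoundPoisson β t))
        - Real.exp (-(t * β.real Set.univ)) * ∑ k ∈ Finset.Icc 1 n, t ^ k / k.factorial *
          ∑ i ∈ Finset.range (n + 1 - k), t ^ i / i.factorial *
            (jumpOp (approxMeasure a q κ h))^[i] (H k z) 0| ≤ C * t ^ (n + 1) := by
  have hr : 0 < ((n + 1 : ℕ) : ℝ) * ε := by positivity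
  -- For z < z₀ the payoff vanishes below 2(n+1)ε, exactly where φ becomes the exponential, so φ
  -- dominates it. The room (n+1)ε left below the support of φ absorbs n applications of the
  -- generator.
  obtain ⟨φ, hφ0, hφz, hφe, hφb⟩ := exists_smooth_majorant hr
  obtain ⟨Mφ, hMφ⟩ := hφb (3 * (n + 1))
  have hex : ∀ k, ∃ M, 1 ≤ k → ∀ z ≤ 0, GrowthBound (3 * (n + 1)) M (H k z) := fun k => by
    by_cases hk : 1 ≤ k
    · obtain ⟨M, hM⟩ := hHb k hk (3 * (n + 1)); exact ⟨M, fun _ => hM⟩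
    · exact ⟨0, fun h => absurd h hk⟩
  choose M hM using hex
  set K := levyBound a q κ
  set W := momentBound a q κ
  set A := ∫ x, Real.exp (1 * x) ∂β
  have hA : 0 ≤ A := integral_nonneg fun x => (Real.exp_pos _).le
  have hK0 : 0 ≤ K := zero_le_one.trans (one_le_levyBound hq)
  have hW0 : 0 ≤ W := zero_le_one.trans (one_le_momentBound a q κ)
  -- Taylor remainder constants for k ≤ n. For k > n the crude bound W Aᵏ/k!, summable in k, takes
  -- over.
  set D : ℕ → ℝ := fun k => if k = 0 then K ^ (n + 1) * Mφ * W
    else if k ≤ n then K ^ (n + 1 - k) * M k * W else 0 with hD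
  have hD0 : ∀ k, 0 ≤ D k := by
    intro k
    simp only [hD]
    split_ifs with h1 h2
    · have := hMφ.nonneg; positivity
    · have := (hM k (by omega) 0 le_rfl).nonneg; positivity
    · exact le_rfl
  set bd : ℕ → ℝ := fun k => D k + W * (A ^ k / k.factorial) with hbd
  have hsum : Summable bd := by
    refine Summable.add (summable_of_ne_finset_zero (s := Finset.range (n + 1)) fun k hk => ?_)
      ((hasSum_pow_div_factorial A).summable.mul_left W)
    have : n < k := by simpa using hk
    simp only [hD]
    rw [if_neg (by omega), if_neg (by omega)]
  refine ⟨∑' k, bd k, fun z hz h hh hhε t ht ht1 => ?_⟩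
  have hh1 : h ≤ 1 := hhε.trans hε1
  have hz0 : z ≤ 0 := by linarith
  have hfin := hκ.isFiniteMeasure_approx a q hh
  set ρ := approxMeasure a q κ h with hρ
  set μ := compoundPoisson ρ t with hμ
  have hρi : Integrable (fun x => Real.exp (2 * x)) ρ := hκ.integrable_approx a q hh (by fun_prop)
  have hμp : IsProbabilityMeasure μ := isProbabilityMeasure_compoundPoisson _ ht
  have hμi : Integrable (fun x => Real.exp (2 * x)) μ := integrable_exp_compoundPoisson _ ht 2 hρi
  have hβp := isProbabilityMeasure_compoundPoisson β ht
  have hck : ∀ k, Integrable (call z) (Measure.conv μ (convMPow β k)) := fun k =>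
    integrable_call (integrable_exp_conv hμi (integrable_exp_convMPow β 2 hβ k)) hz0
  have hT := hasSum_integral_conv_compoundPoisson (β := β) ht
    (integrable_call (integrable_exp_conv hμi (integrable_exp_compoundPoisson β ht 2 hβ)) hz0) hck
  set I : ℕ → ℝ := fun k => ∫ x, call z x ∂(Measure.conv μ (convMPow β k)) with hI
  set Q : ℕ → ℝ := fun k => ∑ i ∈ Finset.range (n + 1 - k), t ^ i / i.factorial *
            (jumpOp ρ)^[i] (H k z) 0 with hQ
  -- The finite expansion written as a series over all k, to be compared term by term with the
  -- series over the number of big jumps.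
  have hS : HasSum (fun k => if k ∈ Finset.Icc 1 n then
      Real.exp (-(t * β.real Set.univ)) * (t ^ k / k.factorial * Q k) else 0)
      (Real.exp (-(t * β.real Set.univ)) * ∑ k ∈ Finset.Icc 1 n, t ^ k / k.factorial * Q k) := by
    rw [Finset.mul_sum, ← Finset.sum_congr rfl fun k hk => if_pos hk]
    exact hasSum_sum_of_ne_finset_zero fun k hk => if_neg hk
  have hexp1 : Real.exp (-(t * β.real Set.univ)) ≤ 1 := by
    rw [Real.exp_le_one_iff]
    have := mul_nonneg ht (measureReal_nonneg (μ := β) (s := Set.univ))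
    linarith
  have hexp0 := (Real.exp_pos (-(t * β.real Set.univ))).le
  have hfac : ∀ k : ℕ, t ^ k / k.factorial ≤ t ^ k := fun k =>
    div_le_self (by positivity) (by exact_mod_cast Nat.one_le_iff_ne_zero.2 k.factorial_ne_zero)
  have hIk0 : ∀ k, 0 ≤ I k := fun k => integral_nonneg fun x => call_nonneg z x
  have hIk : ∀ k, I k ≤ W * A ^ k := by
    intro k
    have hc := integrable_exp_conv (integrable_exp_one hμi)
      (integrable_exp_convMPow β 1 (integrable_exp_one hβ) k)
    have h1 : I k ≤ ∫ x, Real.exp (1 * x) ∂(Measure.conv μ (convMPow β k)) :=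
      integral_mono (hck k) hc fun x => by
        rw [one_mul]; exact call_le_exp hz0 x
    rw [integral_exp_conv (integrable_exp_one hμi)
      (integrable_exp_convMPow β 1 (integrable_exp_one hβ) k),
      integral_exp_convMPow β 1 (integrable_exp_one hβ)] at h1
    have h2 : ∫ x, Real.exp (1 * x) ∂μ ≤ W := by
      refine (integral_mono (integrable_exp_one hμi) (integrable_weight hμi) fun x => ?_).trans
        (hκ.integral_weight_compoundPoisson_le a hq hh hh1 ht ht1)
      simp only [one_mul]
      exact exp_le_weight x
    exact h1.trans (mul_le_mul_of_nonneg_right h2 (by positivity))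
  have hmain : ∀ k, |t ^ k / k.factorial * I k - (if k ∈ Finset.Icc 1 n then
      t ^ k / k.factorial * Q k else 0)| ≤ bd k * t ^ (n + 1) := by
    intro k
    have hWA : 0 ≤ W * (A ^ k / k.factorial) * t ^ (n + 1) := by positivity
    rcases Nat.eq_zero_or_pos k with rfl | hk
    · have hφi : Integrable φ μ := hMφ.integrable (integrable_weight hμi)
      have h1 : I 0 ≤ ∫ x, φ x ∂μ := by
        simp only [hI, convMPow]
        rw [Measure.conv_dirac_zero]
        refine integral_mono (integrable_call hμi hz0) hφi fun x => ?_
        rcases le_total (z + x) 0 with hx | hx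
        · rw [call_eq_zero hx]; exact hφ0 x
        · rw [hφe x (by linarith)]; exact call_le_exp hz0 x
      have h2 := hκ.abs_integral_approx_sub_le a hq hh hh1 ht ht1 (n + 1) hMφ
      rw [Finset.sum_eq_zero, sub_zero] at h2
      · have h3 := (le_abs_self _).trans h2
        have h4 : D 0 = K ^ (n + 1) * Mφ * W := by simp [hD]
        simp only [pow_zero, Nat.factorial_zero, Nat.cast_one, div_one, one_mul, Finset.mem_Icc,
          nonpos_iff_eq_zero, one_ne_zero, false_and, if_false, sub_zero]
        rw [abs_of_nonneg (hIk0 0)]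
        simp only [hbd, add_mul, h4]
        linarith
      · intro j hj
        have hj' : j < n + 1 := by simpa using hj
        -- Here h ≤ ε is used: the artificial jumps ±h must not exceed the range ε. As j ≤ n, the
        -- point 0 is still below (n+1)ε - jε.
        rw [iterate_jumpOp_eq_zero_of_lt (ae_approx hsupp a q hh hhε) hε.le hφz j 0, mul_zero]
        have : (j : ℝ) * ε < ((n + 1 : ℕ) : ℝ) * ε := by gcongr
        linarith
    · by_cases hkn : k ≤ n
      · have hHk := hM k hk z hz0
        have h1 : I k = ∫ y, H k z y ∂μ := by
          simp only [hI]
          rw [integral_conv (hck k)]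
          exact integral_congr_ae (ae_of_all _ fun y => hH k hk z y)
        -- The k big jumps already contribute tᵏ, so a remainder of order n + 1 - k suffices.
        have h2 := hκ.abs_integral_approx_sub_le a hq hh hh1 ht ht1 (n + 1 - k)
          (hHk.of_le (m' := 3 * (n + 1 - k)) (by omega))
        have h4 : D k = K ^ (n + 1 - k) * M k * W := by
          simp only [hD]; rw [if_neg (by omega), if_pos hkn]
        rw [if_pos (Finset.mem_Icc.2 ⟨hk, hkn⟩), ← mul_sub, abs_mul,
          abs_of_nonneg (by positivity : 0 ≤ t ^ k / (k.factorial : ℝ)), h1]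
        calc t ^ k / k.factorial * |∫ y, H k z y ∂μ - Q k|
            ≤ t ^ k * (K ^ (n + 1 - k) * M k * W * t ^ (n + 1 - k)) :=
              mul_le_mul (hfac k) h2 (abs_nonneg _) (by positivity)
          _ = D k * t ^ (n + 1) := by
              rw [h4, ← pow_mul_pow_sub t (show k ≤ n + 1 by omega)]; ring
          _ ≤ bd k * t ^ (n + 1) := by simp only [hbd, add_mul]; linarith
      · rw [if_neg (by simp; omega), sub_zero, abs_mul, abs_of_nonneg (hIk0 k),
          abs_of_nonneg (by positivity : 0 ≤ t ^ k / (k.factorial : ℝ))]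
        have h1 : t ^ k ≤ t ^ (n + 1) := pow_le_pow_of_le_one ht ht1 (by omega)
        calc t ^ k / k.factorial * I k ≤ t ^ (n + 1) / k.factorial * (W * A ^ k) := by
              have := hIk k
              have := hIk0 k
              gcongr
          _ = W * (A ^ k / k.factorial) * t ^ (n + 1) := by ring
          _ ≤ bd k * t ^ (n + 1) := by
              simp only [hbd, add_mul]
              have := mul_nonneg (hD0 k) (pow_nonneg ht (n + 1))
              linarith
  have hfinal := (hT.sub hS).norm_le_of_bounded (hsum.hasSum.mul_right (t ^ (n + 1)))
    fun k => by
      have h1 : Real.exp (-(t * β.real Set.univ)) * (t ^ k / k.factorial * I k)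
          - (if k ∈ Finset.Icc 1 n then
            Real.exp (-(t * β.real Set.univ)) * (t ^ k / k.factorial * Q k) else 0)
          = Real.exp (-(t * β.real Set.univ)) * (t ^ k / k.factorial * I k
            - (if k ∈ Finset.Icc 1 n then t ^ k / k.factorial * Q k else 0)) := by
        split_ifs <;> ring
      rw [h1, norm_mul, Real.norm_eq_abs, Real.norm_eq_abs, abs_of_nonneg hexp0]
      exact (mul_le_of_le_one_left (abs_nonneg _) hexp1).trans (hmain k)
  exact hfinal

/-- The expansion for a family of laws with the characteristic functions of the Lévy process. -/
lemma IsSmallJump.exists_abs_integral_call_law_sub_le (hκ : IsSmallJump κ) {ε : ℝ} (hε : 0 < ε)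
    (hε1 : ε ≤ 1) (hsupp : ∀ᵐ z ∂κ, |z| ≤ ε) (a : ℝ) {q : ℝ} (hq : 0 ≤ q)
    (hβ : Integrable (fun x => Real.exp (2 * x)) β) (n : ℕ) {z₀ : ℝ}
    (hz₀ : z₀ ≤ -(2 * ((n + 1 : ℕ) * ε))) (H : ℕ → ℝ → ℝ → ℝ)
    (hH : ∀ k, 1 ≤ k → ∀ z y, ∫ u, call z (y + u) ∂(convMPow β k) = H k z y)
    (hHb : ∀ k, 1 ≤ k → ∀ m, ∃ M, ∀ z ≤ 0, GrowthBound m M (H k z))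
    (μ : ℝ → ProbabilityMeasure ℝ)
    (hμ : ∀ t, 0 ≤ t → ∀ h : ℕ → ℝ, Tendsto h atTop (𝓝[>] 0) → (∀ N, 0 < h N) →
      ∀ u, Tendsto (fun N => charFun (Measure.conv
        (compoundPoisson (approxMeasure a q κ (h N)) t) (compoundPoisson β t)) u) atTop
        (𝓝 (charFun (μ t : Measure ℝ) u))) :
    ∃ C, ∀ z < z₀, ∀ t, 0 ≤ t → t ≤ 1 →
      |∫ x, call z x ∂(μ t : Measure ℝ)
        - Real.exp (-(t * β.real Set.univ)) * ∑ k ∈ Finset.Icc 1 n, t ^ k / k.factorial *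
          ∑ i ∈ Finset.range (n + 1 - k), t ^ i / i.factorial *
            (levyOp a q κ)^[i] (H k z) 0| ≤ C * t ^ (n + 1) := by
  obtain ⟨C, hC⟩ := hκ.exists_abs_integral_call_sub_le hε hε1 hsupp a hq hβ n hz₀ H hH hHb
  refine ⟨C, fun z hz t ht ht1 => ?_⟩
  have hz0 : z ≤ 0 := by
    have : 0 ≤ 2 * (((n + 1 : ℕ) : ℝ) * ε) := by positivity
    linarith
  obtain ⟨h, hpos, hle, hlim⟩ := exists_seq_tendsto_nhdsGT_zero hε
  have hfin := fun N => hκ.isFiniteMeasure_approx a q (hpos N)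
  have hp1 := fun N => isProbabilityMeasure_compoundPoisson (approxMeasure a q κ (h N)) ht
  have hp2 := isProbabilityMeasure_compoundPoisson β ht
  set ρ : ℕ → ProbabilityMeasure ℝ := fun N => ⟨Measure.conv
    (compoundPoisson (approxMeasure a q κ (h N)) t) (compoundPoisson β t), inferInstance⟩ with hρ
  -- Lévy's continuity theorem.
  have hweak : Tendsto ρ atTop (𝓝 (μ t)) :=
    ProbabilityMeasure.tendsto_of_tendsto_charFun fun u => hμ t ht h hlim hpos u
  have hi1 : ∀ N, Integrable (fun x => Real.exp (2 * x))
      (compoundPoisson (approxMeasure a q κ (h N)) t) := fun N =>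
    integrable_exp_compoundPoisson _ ht 2 (hκ.integrable_approx a q (hpos N) (by fun_prop))
  have hi2 := integrable_exp_compoundPoisson β ht 2 hβ
  have hconv := tendsto_integral_of_le_exp hweak
    (K := Real.exp (t * (16 * levyBound a q κ)) * ∫ x, Real.exp (2 * x) ∂(compoundPoisson β t))
    (fun N => integrable_exp_conv (hi1 N) hi2)
    (fun N => by
      have : ∫ x, Real.exp (2 * x) ∂((ρ N : ProbabilityMeasure ℝ) : Measure ℝ)
        = _ := integral_exp_conv (hi1 N) hi2
      rw [this]
      refine mul_le_mul_of_nonneg_right ?_ (integral_nonneg fun x => (Real.exp_pos _).le)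
      exact hκ.integral_exp_compoundPoisson_le a hq (hpos N) ((hle N).trans hε1) ht)
    (continuous_call z) (call_nonneg z) (call_le_exp hz0)
  have hterm : ∀ k ∈ Finset.Icc 1 n, ∀ i, Tendsto
      (fun N => (jumpOp (approxMeasure a q κ (h N)))^[i] (H k z) 0) atTop
      (𝓝 ((levyOp a q κ)^[i] (H k z) 0)) := by
    intro k hk i
    obtain ⟨M, hM⟩ := hHb k (Finset.mem_Icc.1 hk).1 (3 * i)
    refine ((hκ.tendsto_iterate_approx a hq i (hM z hz0) 0).comp hlim).congr fun N => ?_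
    rw [Function.comp_apply, hκ.iterate_jumpOp_approx a hq (hpos N) ((hle N).trans hε1) i
      (hM z hz0)]
  have hsum : Tendsto (fun N => Real.exp (-(t * β.real Set.univ)) *
      ∑ k ∈ Finset.Icc 1 n, t ^ k / k.factorial *
          ∑ i ∈ Finset.range (n + 1 - k), t ^ i / i.factorial *
            (jumpOp (approxMeasure a q κ (h N)))^[i] (H k z) 0) atTop
      (𝓝 (Real.exp (-(t * β.real Set.univ)) *
      ∑ k ∈ Finset.Icc 1 n, t ^ k / k.factorial *
          ∑ i ∈ Finset.range (n + 1 - k), t ^ i / i.factorial *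
            (levyOp a q κ)^[i] (H k z) 0)) :=
    (tendsto_finsetSum _ fun k hk => (tendsto_finsetSum _ fun i _ =>
      (hterm k hk i).const_mul _).const_mul _).const_mul _
  -- C does not depend on h, so the inequality survives the limit.
  refine le_of_tendsto (hconv.sub hsum).abs (Eventually.of_forall fun N => ?_)
  exact hC z hz (h N) (hpos N) (hle N) t ht ht1

end Expansion

/-! ### Identification of the coefficients and of the law of the process. -/

lemma hHat_spec {ν : Measure ℝ} {s c : ℝ → ℝ} {ε : ℝ} (hc : IsTruncation ε c) (hε : 0 < ε)
    (hε1 : ε < 1) (hν : IsLevyMeasure ν) (hs : HasSmoothDensity ν s) (hexp : HasExpMoment ν)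
    {k : ℕ} (hk : 1 ≤ k) :
    (∀ z y, ∫ u, call z (y + u) ∂(convMPow (bigJumps ν c) k) = hHat s c k z y) ∧
      ∀ m, ∃ M, ∀ z ≤ 0, GrowthBound m M (hHat s c k z) := by
  obtain ⟨k, rfl⟩ := Nat.exists_eq_add_of_le' hk
  have hfin := hc.isFiniteMeasure_bigJumps hε hε1 hν
  have hβ := hc.integrable_exp_bigJumps hε hε1 hν hexp
  have hnn := hc.bigDensity_nonneg hε hs
  have hbd := hc.bddDeriv_bigDensity hε hs
  have hcont : Continuous fun v => (1 - c v) * s v := (hbd 0).choose_spec.continuous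
  have hi : Integrable fun v => (1 - c v) * s v := by
    have h1 : Integrable (fun _ => (1 : ℝ)) (bigJumps ν c) := integrable_const 1
    rw [hc.bigJumps_eq hs, integrable_densMeasure_iff hcont hnn] at h1
    simpa using h1
  obtain ⟨h0, hb, hm⟩ := convPow_spec hnn hi hbd k
  have hfc : Continuous (convPow (fun v => (1 - c v) * s v) (k + 1)) :=
    (hb 0).choose_spec.continuous
  have h1 := integrable_exp_one (integrable_exp_convMPow (bigJumps ν c) 2 hβ (k + 1))
  have h2 : Integrable (fun _ => (1 : ℝ)) (convMPow (bigJumps ν c) (k + 1)) := integrable_const 1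
  rw [hc.bigJumps_eq hs, hm, integrable_densMeasure_iff hfc h0] at h1 h2
  simp only [one_mul] at h1 h2
  refine ⟨fun z y => ?_, fun m => ?_⟩
  · rw [hc.bigJumps_eq hs, hm, integral_densMeasure hfc h0]
    simp only [hHat, call, add_assoc]
  · obtain ⟨C, hC⟩ := hb m
    exact ⟨_, fun z hz => ((growthBound_call h0 h2 hC h1).of_le (Nat.le_succ m)).comp_const_add hz⟩

/-- Since binom(j,k)/j! = 1/(k!(j-k)!), setting i = j - k turns the sum by total power of t into the
sum by number of big jumps. -/
lemma sum_coeff_eq (n : ℕ) (t : ℝ) (X : ℕ → ℕ → ℝ) :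
    ∑ j ∈ Finset.Icc 1 n, (∑ k ∈ Finset.Icc 1 j, (j.choose k : ℝ) * X k (j - k)) * t ^ j /
      (j.factorial : ℝ)
    = ∑ k ∈ Finset.Icc 1 n, t ^ k / k.factorial *
        ∑ i ∈ Finset.range (n + 1 - k), t ^ i / i.factorial * X k i := by
  have h1 : ∀ j ∈ Finset.Icc 1 n, (∑ k ∈ Finset.Icc 1 j, (j.choose k : ℝ) * X k (j - k)) * t ^ j /
      (j.factorial : ℝ) = ∑ k ∈ Finset.Icc 1 j,
        t ^ k / k.factorial * (t ^ (j - k) / (j - k).factorial * X k (j - k)) := by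
    intro j _
    rw [Finset.sum_mul, Finset.sum_div]
    refine Finset.sum_congr rfl fun k hk => ?_
    have hkj := (Finset.mem_Icc.1 hk).2
    rw [Nat.cast_choose ℝ hkj, ← pow_mul_pow_sub t hkj]
    have : (j.factorial : ℝ) ≠ 0 := by positivity
    field_simp
  rw [Finset.sum_congr rfl h1, Finset.sum_comm' (t' := Finset.Icc 1 n)
    (s' := fun k => Finset.Ico k (n + 1)) (by intro j k; simp only [Finset.mem_Icc, Finset.mem_Ico]; omega)]
  refine Finset.sum_congr rfl fun k _ => ?_
  rw [← Finset.mul_sum, Finset.sum_Ico_eq_sum_range]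
  simp

/-- The law of a Lévy process is the limit in law of the approximating compound Poisson laws. -/
lemma tendsto_charFun_law {Ω : Type*} [MeasurableSpace Ω] {P : Measure Ω}
    {Z : ℝ≥0 → Ω → ℝ} {b σ : ℝ} {ν : Measure ℝ} (hZ : IsLevyProcessWithTriplet Z P b σ ν)
    {ε : ℝ} (hε : 0 < ε) (hε1 : ε < 1) {c : ℝ → ℝ} (hc : IsTruncation ε c) (t : ℝ≥0) (u : ℝ)
    {h : ℕ → ℝ} (hlim : Tendsto h atTop (𝓝[>] 0)) (hpos : ∀ N, 0 < h N) :
    Tendsto (fun N => charFun (Measure.conv (compoundPoisson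
        (approxMeasure (truncatedDrift b ν c) (σ ^ 2 / 2) (smallJumps ν c) (h N)) t)
        (compoundPoisson (bigJumps ν c) t)) u) atTop (𝓝 (charFun (P.map (Z t)) u)) := by
  have hν := hZ.levyMeasure
  have hκ := hc.isSmallJump hε1 hν
  have hfin := hc.isFiniteMeasure_bigJumps hε hε1 hν
  have hp2 := isProbabilityMeasure_compoundPoisson (bigJumps ν c) t.coe_nonneg
  -- The big-jump factor is exact for every N; only the small-jump factor is a limit.
  rw [hZ.charFun_eq, hc.levyExponent_eq hε hε1 b σ hν, mul_add, Complex.exp_add]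
  have h1 := (hκ.tendsto_charFun_approx (truncatedDrift b ν c) (q := σ ^ 2 / 2) (by positivity)
    t.coe_nonneg u).comp hlim
  refine (h1.mul_const _).congr fun N => ?_
  have := hκ.isFiniteMeasure_approx (truncatedDrift b ν c) (σ ^ 2 / 2) (hpos N)
  have := isProbabilityMeasure_compoundPoisson
    (approxMeasure (truncatedDrift b ν c) (σ ^ 2 / 2) (smallJumps ν c) (h N)) t.coe_nonneg
  rw [charFun_conv]
  exact congrArg _ (charFun_compoundPoisson (bigJumps ν c) t.coe_nonneg u).symm

/-- The second exponential moment is inherited from the approximating laws, whose moments are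
bounded uniformly in h at each fixed t. It makes the call price finite at all times and for all z.
-/
lemma integrable_exp_law {Ω : Type*} [MeasurableSpace Ω] {P : Measure Ω} [IsProbabilityMeasure P]
    {Z : ℝ≥0 → Ω → ℝ} {b σ : ℝ} {ν : Measure ℝ} (hZ : IsLevyProcessWithTriplet Z P b σ ν)
    (hexp : HasExpMoment ν)
    {ε : ℝ} (hε : 0 < ε) (hε1 : ε < 1) {c : ℝ → ℝ} (hc : IsTruncation ε c) (t : ℝ≥0) :
    Integrable (fun x => Real.exp (2 * x)) (P.map (Z t)) := by
  have hν := hZ.levyMeasure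
  have hκ := hc.isSmallJump hε1 hν
  have hfin := hc.isFiniteMeasure_bigJumps hε hε1 hν
  have hβ := hc.integrable_exp_bigJumps hε hε1 hν hexp
  have hp2 := isProbabilityMeasure_compoundPoisson (bigJumps ν c) t.coe_nonneg
  have hprob := Measure.isProbabilityMeasure_map (μ := P) (hZ.measurable t).aemeasurable
  obtain ⟨h, hpos, hle, hlim⟩ := exists_seq_tendsto_nhdsGT_zero hε
  have hfin' := fun N => hκ.isFiniteMeasure_approx (truncatedDrift b ν c) (σ ^ 2 / 2) (hpos N)
  have hp1 := fun N => isProbabilityMeasure_compoundPoisson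
    (approxMeasure (truncatedDrift b ν c) (σ ^ 2 / 2) (smallJumps ν c) (h N)) t.coe_nonneg
  have hi1 : ∀ N, Integrable (fun x => Real.exp (2 * x)) (compoundPoisson
      (approxMeasure (truncatedDrift b ν c) (σ ^ 2 / 2) (smallJumps ν c) (h N)) t) := fun N =>
    integrable_exp_compoundPoisson _ t.coe_nonneg 2 (hκ.integrable_approx _ _ (hpos N) (by fun_prop))
  have hi2 := integrable_exp_compoundPoisson (bigJumps ν c) t.coe_nonneg 2 hβ
  have hweak := ProbabilityMeasure.tendsto_of_tendsto_charFun
    (μ := fun N => ⟨Measure.conv (compoundPoisson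
      (approxMeasure (truncatedDrift b ν c) (σ ^ 2 / 2) (smallJumps ν c) (h N)) t)
      (compoundPoisson (bigJumps ν c) t), inferInstance⟩) (μ₀ := ⟨P.map (Z t), hprob⟩)
    fun u => tendsto_charFun_law hZ hε hε1 hc t u hlim hpos
  refine (integrable_exp_of_tendsto hweak
    (K := Real.exp (t * (16 * levyBound (truncatedDrift b ν c) (σ ^ 2 / 2) (smallJumps ν c)))
      * ∫ x, Real.exp (2 * x) ∂(compoundPoisson (bigJumps ν c) t))
    (fun N => integrable_exp_conv (hi1 N) hi2) fun N => ?_).1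
  refine (integral_exp_conv (hi1 N) hi2).trans_le ?_
  refine mul_le_mul_of_nonneg_right ?_ (integral_nonneg fun x => (Real.exp_pos _).le)
  exact hκ.integral_exp_compoundPoisson_le _ (by positivity) (hpos N) ((hle N).trans hε1.le) t.coe_nonneg

end LevyOption

end

/-! ### The theorem. -/

open LevyOption in
theorem mainTheorem8 {Ω : Type*} [MeasurableSpace Ω] (P : Measure Ω) [IsProbabilityMeasure P]
    (Z : ℝ≥0 → Ω → ℝ) (b σ : ℝ) (ν : Measure ℝ) (s : ℝ → ℝ)
    (hZ : LevyOption.IsLevyProcessWithTriplet Z P b σ ν)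
    (hs : LevyOption.HasSmoothDensity ν s)
    (hν : LevyOption.HasExpMoment ν)
    (z₀ : ℝ) (hz₀ : z₀ < 0) (n : ℕ) (hn : 1 ≤ n)
    (ε : ℝ) (hε : 0 < ε) (hε' : ε < min (-z₀ / (2 * ((n : ℝ) + 1))) 1)
    (c : ℝ → ℝ) (hc : LevyOption.IsTruncation ε c) :
    (∀ (t : ℝ≥0) (z : ℝ), Integrable (fun ω => max (Real.exp (z + Z t ω) - 1) 0) P) ∧
    ∃ t₀ : ℝ≥0, 0 < t₀ ∧ ∃ C : ℝ, ∀ z : ℝ, z < z₀ → ∀ t : ℝ≥0, 0 < t → t ≤ t₀ →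
      |LevyOption.callPrice Z P t z
        - Real.exp (-LevyOption.jumpIntensity ν c * (t : ℝ))
          * ∑ j ∈ Finset.Icc 1 n,
              LevyOption.coeff b σ ν s c j z * (t : ℝ) ^ j / (j.factorial : ℝ)|
        ≤ C * (t : ℝ) ^ (n + 1) := by
  have hε1 : ε < 1 := hε'.trans_le (min_le_right _ _)
  have hεz : ε < -z₀ / (2 * ((n : ℝ) + 1)) := hε'.trans_le (min_le_left _ _)
  have hLevy := hZ.levyMeasure
  have hκ := hc.isSmallJump hε1 hLevy
  have hfin := hc.isFiniteMeasure_bigJumps hε hε1 hLevy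
  have hβ := hc.integrable_exp_bigJumps hε hε1 hLevy hν
  have hprob := fun t => Measure.isProbabilityMeasure_map (μ := P) (hZ.measurable t).aemeasurable
  -- All remainder estimates hold on [0, 1], so t₀ = 1 serves.
  refine ⟨fun t z => ?_, 1, one_pos, ?_⟩
  · have h1 := integrable_exp_law hZ hν hε hε1 hc t
    have h2 : Integrable (fun x => max (Real.exp (z + x) - 1) 0) (P.map (Z t)) := by
      refine ((integrable_weight h1).const_mul (Real.exp z)).mono' (by fun_prop)
        (ae_of_all _ fun x => ?_)
      rw [Real.norm_eq_abs, abs_of_nonneg (le_max_right _ _)]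
      refine max_le ?_ (by have := weight_pos x; positivity)
      rw [Real.exp_add]
      have := mul_le_mul_of_nonneg_left (exp_le_weight x) (Real.exp_pos z).le
      linarith
    exact h2.comp_measurable (hZ.measurable t)
  · have hz : z₀ ≤ -(2 * ((n + 1 : ℕ) * ε)) := by
      rw [lt_div_iff₀ (by positivity)] at hεz
      push_cast
      linarith
    obtain ⟨C, hC⟩ := hκ.exists_abs_integral_call_law_sub_le hε hε1.le (hc.ae_smallJumps ν)
      (truncatedDrift b ν c) (q := σ ^ 2 / 2) (by positivity) hβ n hz (hHat s c)
      (fun k hk => (hHat_spec hc hε hε1 hLevy hs hν hk).1)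
      (fun k hk => (hHat_spec hc hε hε1 hLevy hs hν hk).2)
      -- The expansion is stated for real times; negative ones are sent to 0 and never used.
      (fun t => ⟨P.map (Z t.toNNReal), hprob _⟩)
      (fun t ht h hlim hpos u => by
        have := tendsto_charFun_law hZ hε hε1 hc t.toNNReal u hlim hpos
        rwa [Real.coe_toNNReal t ht] at this)
    refine ⟨C, fun z hz t ht ht1 => ?_⟩
    have key := hC z hz t t.coe_nonneg (by exact_mod_cast ht1)
    have e1 : callPrice Z P t z = ∫ x, call z x ∂(P.map (Z (t : ℝ).toNNReal)) := by
      rw [Real.toNNReal_coe, integral_map (hZ.measurable t).aemeasurable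
        (continuous_call z).aestronglyMeasurable]
      rfl
    have e2 := sum_coeff_eq n t fun k i =>
      (smallJumpGenerator b σ ν c)^[i] (hHat s c k z) 0
    unfold coeff
    rw [e2, e1, hc.jumpIntensity_eq, hc.smallJumpGenerator_eq hε1, neg_mul, mul_comm _ (t : ℝ)]
    exact key
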